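/- For integers $k,n\ge 0$ let $\triangle_k(n)$ denote the number of representations of $n$ as an ordered sum of $k$ triangular numbers $r(r+1)/2$, $r\ge 0$; equivalently, $\left(\sum_{r\ge 0}q^{r(r+1)/2}\right)^k=\sum_{n\ge 0}\triangle_k(n)q^n$. Then for all integers $m\ge 0$ and $n\ge 0$ (empty sums being $0$ and empty products $1$), $$\triangle_{4m^2}(n)=\frac{1}{4^{m(m-1)}\,m!\,\prod_{j=1}^{2m-1}j!}\sum_{\substack{k_1l_1+\dots+k_ml_m=2n+m^2\\ k_i\text{ and }l_i\text{ odd positive}}}\ \prod_{i=1}^m k_i\prod_{1\le i<j\le m}(k_j^2-k_i^2)^2$$ and $$\triangle_{4m(m+1)}(n)=\frac{2^m}{m!\,\prod_{j=1}^{2m}j!}\sum_{\substack{k_1l_1+\dots+k_ml_m=n+\frac12m(m+1)\\ k_i\text{ positive},\ l_i\text{ odd positive}}}\ \prod_{i=1}^m k_i^3\prod_{1\le i<j\le m}(k_j^2-k_i^2)^2,$$ where the sums run over all pairs of $m$-tuples of integers $(k_1,\dots,k_m)$, $(l_1,\dots,l_m)$ satisfying the stated conditions. -/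

import Mathlib

open scoped Nat

/-- `t` is a triangular number: `t = 0, 1, 3, 6, 10, …`. -/
def IsTriangular (t : ℕ) : Prop := ∃ r : ℕ, t = r * (r + 1) / 2

/-- The ordered representations of `n` as a sum of `k` triangular numbers (reordering the terms
gives a different representation). -/
def triangleReps (k n : ℕ) : Set (Fin k → ℕ) :=
  {t | (∀ i, IsTriangular (t i)) ∧ ∑ i, t i = n}

/-- The number `△_k(n)` of representations of `n` as an ordered sum of `k` triangular numbers. -/
noncomputable def triangleCount (k n : ℕ) : ℕ := (triangleReps k n).ncard

open Classical in
/-- The generating series `△(q) = ∑_{r ≥ 0} q^{r(r+1)/2}` of the triangular numbers. -/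
noncomputable def triangleSeries : PowerSeries ℕ :=
  PowerSeries.mk fun t => if IsTriangular t then 1 else 0

theorem triangleReps_finite (k n : ℕ) : (triangleReps k n).Finite := by
  refine (Set.finite_Iic (fun _ : Fin k => n)).subset ?_
  rintro t ⟨-, ht⟩ i
  calc t i ≤ ∑ j, t j := Finset.single_le_sum (fun _ _ => Nat.zero_le _) (Finset.mem_univ i)
    _ = n := ht

/-- `△(q)^k = ∑_n △_k(n) q^n`. -/
theorem coeff_triangleSeries_pow (k n : ℕ) :
    PowerSeries.coeff n (triangleSeries ^ k) = triangleCount k n := by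
  classical
  have h : triangleSeries ^ k = ∏ _i : Fin k, triangleSeries := by simp
  rw [h, PowerSeries.coeff_prod, triangleCount, Set.ncard_eq_toFinset_card _ (triangleReps_finite k n)]
  simp only [triangleSeries, PowerSeries.coeff_mk]
  rw [Finset.card_eq_sum_ones]
  simp only [Finset.prod_ite_zero, Finset.prod_const_one]
  rw [← Finset.sum_filter]
  refine Finset.sum_bij' (fun f _ => (fun i => f i)) (fun t _ => Finsupp.equivFunOnFinite.symm t)
    ?_ ?_ ?_ ?_ ?_
  · intro f hf
    simp [triangleReps, Finset.mem_finsuppAntidiag] at hf ⊢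
    tauto
  · intro t ht
    simp [triangleReps, Finset.mem_finsuppAntidiag] at ht ⊢
    tauto
  · intro f _
    ext i
    simp
  · intro t _
    ext i
    simp
  · intros
    rfl

/-- Pairs `(k, l)` of `m`-tuples of odd positive integers with `k₁l₁ + ⋯ + k_ml_m = N`. -/
def oddOddSolutions (m N : ℕ) : Set ((Fin m → ℕ) × (Fin m → ℕ)) :=
  {p | (∀ i, Odd (p.1 i) ∧ 0 < p.1 i) ∧ (∀ i, Odd (p.2 i) ∧ 0 < p.2 i) ∧
    ∑ i, p.1 i * p.2 i = N}

/-- Pairs `(k, l)` of `m`-tuples of positive integers, all entries of `l` being odd, with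
`k₁l₁ + ⋯ + k_ml_m = N`. -/
def posOddSolutions (m N : ℕ) : Set ((Fin m → ℕ) × (Fin m → ℕ)) :=
  {p | (∀ i, 0 < p.1 i) ∧ (∀ i, Odd (p.2 i) ∧ 0 < p.2 i) ∧ ∑ i, p.1 i * p.2 i = N}

theorem posOddSolutions_finite (m N : ℕ) : (posOddSolutions m N).Finite := by
  refine ((Set.finite_Iic (fun _ : Fin m => N)).prod (Set.finite_Iic (fun _ : Fin m => N))).subset ?_
  rintro p ⟨hk, hl, h⟩
  have key : ∀ i, p.1 i * p.2 i ≤ N := fun i =>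
    (Finset.single_le_sum (f := fun i => p.1 i * p.2 i) (fun _ _ => Nat.zero_le _)
      (Finset.mem_univ i)).trans h.le
  exact ⟨fun i => (Nat.le_mul_of_pos_right _ (hl i).2).trans (key i),
    fun i => (Nat.le_mul_of_pos_left _ (hk i)).trans (key i)⟩

theorem oddOddSolutions_finite (m N : ℕ) : (oddOddSolutions m N).Finite :=
  (posOddSolutions_finite m N).subset fun _ h => ⟨fun i => (h.1 i).2, h.2.1, h.2.2⟩

/-- `∏_{i<j} (k_j² - k_i²)²`. -/
def sqVandermondeSq {m : ℕ} (k : Fin m → ℕ) : ℚ :=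
  ∏ i : Fin m, ∏ j ∈ Finset.Ioi i, ((k j : ℚ) ^ 2 - (k i : ℚ) ^ 2) ^ 2

/-! Let S(x) be the sum over all odd n of y/(1-y²) at y = x qⁿ, an elliptic function whose expansion
is `sinhSeries`, the sum of (x^k - x^{-k}) q^{kl} over odd k, l. Put x = e^u and D = d/du. Then S''
= bS + 8S³ with b independent of u (`sinhSeries_ode`), and e = S'² - bS² - 4S⁴ is constant. Hence D²
acts tridiagonally on the odd powers of S, and on the even ones modulo constants.

The derivatives of S at u = 0 are the moments 2 ∑ k^{2r+1} q^{kl}. A tridiagonal recurrence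
evaluates their Hankel determinant as a product of off-diagonal entries; these involve only e, which
at u = 0 equals S'(0)² because S(0) = 0. So the determinant is a constant times the m²-th power of ∑
k q^{kl} over odd k, l (`det_oddMoment`). Using S² in place of S gives the second family, with power
m(m+1) (`det_moment`).

Jacobi's four triangle theorem (`oddMoment_zero`) says that this sum is q△(q²)⁴, so the determinants
are powers of △. It comes from the same elliptic identities at x = i, combined with a uniqueness
statement for arithmetic-geometric mean relations between theta series (`agm_unique`).

Expanding the Hankel determinant of moments by Andréief's identity (`sum_solutions_eq_det`) turns it
into the sum over solutions weighted by the squared Vandermonde product, and comparing coefficients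
gives both formulas. -/

/-! ### Hankel determinants from a second-order differential equation. -/

section Hankel

variable {B : Type*} [CommRing B]

/-- The first row of the `i`-th power of a tridiagonal matrix with lower, main and upper
diagonals `α`, `β`, `γ`. -/
def tridiagRow (α β γ : ℕ → B) : ℕ → ℕ → B
  | 0, 0 => 1
  | 0, _ + 1 => 0
  | i + 1, 0 => β 0 * tridiagRow α β γ i 0 + α 0 * tridiagRow α β γ i 1
  | i + 1, n + 1 => γ n * tridiagRow α β γ i n + β (n + 1) * tridiagRow α β γ i (n + 1) +
      α (n + 1) * tridiagRow α β γ i (n + 2)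

theorem tridiagRow_eq_zero (α β γ : ℕ → B) (i : ℕ) :
    ∀ n, i < n → tridiagRow α β γ i n = 0 := by
  induction i with
  | zero =>
    rintro (_ | n) h
    · omega
    · simp [tridiagRow]
  | succ i ih =>
    rintro (_ | n) h
    · omega
    · simp [tridiagRow, ih n (by omega), ih (n + 1) (by omega), ih (n + 2) (by omega)]

theorem tridiagRow_self (α β γ : ℕ → B) (i : ℕ) :
    tridiagRow α β γ i i = ∏ j ∈ Finset.range i, γ j := by
  induction i with
  | zero => simp [tridiagRow]
  | succ i ih =>
    rw [tridiagRow, ih, tridiagRow_eq_zero α β γ i (i + 1) (by omega),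
      tridiagRow_eq_zero α β γ i (i + 2) (by omega), Finset.prod_range_succ]
    ring

/-- With J the tridiagonal matrix, V (r+1) = J V r, so V (i+j) 0 is the first row of J^i applied to
V j. That row vanishes beyond index i, so any cutoff M > i is enough. -/
theorem tridiag_moment {α β γ : ℕ → B} {V : ℕ → ℕ → B}
    (hs0 : ∀ r, V (r + 1) 0 = β 0 * V r 0 + γ 0 * V r 1)
    (hs : ∀ r n, V (r + 1) (n + 1) =
      α n * V r n + β (n + 1) * V r (n + 1) + γ (n + 1) * V r (n + 2)) (i : ℕ) :
    ∀ j M, i < M → V (i + j) 0 = ∑ n ∈ Finset.range M, tridiagRow α β γ i n * V j n := by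
  induction i with
  | zero =>
    rintro j (_ | M) h
    · omega
    · simp [Finset.sum_range_succ', tridiagRow]
  | succ i ih =>
    rintro j (_ | M) h
    · omega
    rw [show i + 1 + j = i + (j + 1) by ring, ih (j + 1) (M + 1) (by omega)]
    set U := tridiagRow α β γ with hU
    have hα : ∑ n ∈ Finset.range M, α n * U i (n + 1) * V j n =
        ∑ n ∈ Finset.range M, α (n + 1) * U i (n + 2) * V j (n + 1) + α 0 * U i 1 * V j 0 := by
      rw [← Finset.sum_range_succ' (fun n => α n * U i (n + 1) * V j n), Finset.sum_range_succ,
        hU, tridiagRow_eq_zero α β γ i (M + 1) (by omega)]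
      ring
    have hγ : ∑ n ∈ Finset.range M, γ n * U i n * V j (n + 1) =
        ∑ n ∈ Finset.range M, γ (n + 1) * U i (n + 1) * V j (n + 2) + γ 0 * U i 0 * V j 1 := by
      rw [← Finset.sum_range_succ' (fun n => γ n * U i n * V j (n + 1)), Finset.sum_range_succ,
        hU, tridiagRow_eq_zero α β γ i M (by omega)]
      ring
    have e1 : ∀ n, U (i + 1) (n + 1) = γ n * U i n + β (n + 1) * U i (n + 1) +
        α (n + 1) * U i (n + 2) := fun n => rfl
    have e0 : U (i + 1) 0 = β 0 * U i 0 + α 0 * U i 1 := rfl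
    rw [Finset.sum_range_succ', Finset.sum_range_succ', hs0, e0]
    have t1 : ∑ n ∈ Finset.range M, U i (n + 1) * V (j + 1) (n + 1) =
        ∑ n ∈ Finset.range M, α n * U i (n + 1) * V j n +
        ∑ n ∈ Finset.range M, β (n + 1) * U i (n + 1) * V j (n + 1) +
        ∑ n ∈ Finset.range M, γ (n + 1) * U i (n + 1) * V j (n + 2) := by
      rw [← Finset.sum_add_distrib, ← Finset.sum_add_distrib]
      refine Finset.sum_congr rfl fun n _ => ?_
      rw [hs]; ring
    have t2 : ∑ n ∈ Finset.range M, U (i + 1) (n + 1) * V j (n + 1) =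
        ∑ n ∈ Finset.range M, γ n * U i n * V j (n + 1) +
        ∑ n ∈ Finset.range M, β (n + 1) * U i (n + 1) * V j (n + 1) +
        ∑ n ∈ Finset.range M, α (n + 1) * U i (n + 2) * V j (n + 1) := by
      rw [← Finset.sum_add_distrib, ← Finset.sum_add_distrib]
      refine Finset.sum_congr rfl fun n _ => ?_
      rw [e1]; ring
    rw [t1, t2, hα, hγ]
    ring

/-- The Hankel determinant of the moments of a tridiagonal matrix. -/
theorem det_hankel_tridiag {α β γ : ℕ → B} {V : ℕ → ℕ → B} {c : B} (h0 : V 0 0 = c)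
    (h0' : ∀ n, V 0 (n + 1) = 0)
    (hs0 : ∀ r, V (r + 1) 0 = β 0 * V r 0 + γ 0 * V r 1)
    (hs : ∀ r n, V (r + 1) (n + 1) =
      α n * V r n + β (n + 1) * V r (n + 1) + γ (n + 1) * V r (n + 2)) (m : ℕ) :
    (Matrix.of fun i j : Fin m => V (i + j) 0).det =
      ∏ n ∈ Finset.range m, (c * ∏ j ∈ Finset.range n, α j * γ j) := by
  have V0 : ∀ r n, r < n → V r n = 0 := by
    intro r
    induction r with
    | zero =>
      rintro (_ | n) h
      · omega
      · exact h0' n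
    | succ r ih =>
      rintro (_ | n) h
      · omega
      · rw [hs, ih n (by omega), ih (n + 1) (by omega), ih (n + 2) (by omega)]; ring
  have V1 : ∀ n, V n n = c * ∏ j ∈ Finset.range n, α j := by
    intro n
    induction n with
    | zero => simp [h0]
    | succ n ih =>
      rw [hs, ih, V0 n (n + 1) (by omega), V0 n (n + 2) (by omega), Finset.prod_range_succ]
      ring
  -- Both factors are lower triangular, with diagonals ∏ γ and c ∏ α; the main diagonal β therefore
  -- does not affect the determinant.
  have hM : (Matrix.of fun i j : Fin m => V (i + j) 0) =
      (Matrix.of fun i n : Fin m => tridiagRow α β γ i n) *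
        (Matrix.of fun j n : Fin m => V j n).transpose := by
    ext i j
    rw [Matrix.mul_apply, Matrix.of_apply, tridiag_moment hs0 hs i j m i.2, Finset.sum_range]
    simp
  rw [hM, Matrix.det_mul, Matrix.det_transpose, Matrix.det_of_isLowerTriangular,
    Matrix.det_of_isLowerTriangular, ← Finset.prod_mul_distrib, Finset.prod_range]
  · refine Finset.prod_congr rfl fun n _ => ?_
    simp only [Matrix.of_apply]
    rw [tridiagRow_self, V1, Finset.prod_mul_distrib]
    ring
  · intro i j h
    exact V0 _ _ h
  · intro i j h
    exact tridiagRow_eq_zero _ _ _ _ _ h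

variable {R A : Type*} [CommRing R] [CommRing A] [Algebra R A] (D : Derivation R A A) {y b : A}

theorem derivation_iterate_const_mul {a : A} (ha : D a = 0) (z : A) (r : ℕ) :
    D^[r] (a * z) = a * D^[r] z := by
  induction r with
  | zero => rfl
  | succ r ih => rw [Function.iterate_succ_apply', ih, Function.iterate_succ_apply', D.leibniz, ha]; simp

theorem derivation_iterate_add (z w : A) (r : ℕ) : D^[r] (z + w) = D^[r] z + D^[r] w := by
  induction r with
  | zero => rfl
  | succ r ih => simp only [Function.iterate_succ_apply', ih, map_add]

/-- Conservation of energy: multiply the equation by 2y' and integrate. -/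
theorem derivation_first_integral (hb : D b = 0) (hy : D (D y) = b * y + 8 * y ^ 3) :
    D (D y ^ 2 - b * y ^ 2 - 4 * y ^ 4) = 0 := by
  have h4 : D (4 : A) = 0 := D.map_natCast 4
  simp only [map_sub, D.leibniz, D.leibniz_pow, hb, h4, hy, smul_eq_mul, nsmul_eq_mul]
  push_cast
  ring

/-- Eliminating y'² through the first integral leaves only powers of y of the same parity; this is
the source of the tridiagonal matrix. -/
theorem derivation_sq_pow (hy : D (D y) = b * y + 8 * y ^ 3) (k : ℕ) :
    D (D (y ^ (k + 2))) =
      ((k + 2) * (k + 1) * (D y ^ 2 - b * y ^ 2 - 4 * y ^ 4)) * y ^ k +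
        ((k + 2) ^ 2 * b) * y ^ (k + 2) + (4 * (k + 2) * (k + 3)) * y ^ (k + 4) := by
  have hn : D ((k : A) + 2) = 0 := by
    have := D.map_natCast (k + 2); push_cast at this; exact this
  rw [D.leibniz_pow]
  simp only [smul_eq_mul, nsmul_eq_mul, D.leibniz, D.leibniz_pow, hy, Nat.add_sub_cancel,
    show k + 2 - 1 = k + 1 by omega]
  push_cast
  rw [hn]
  ring

theorem prod_factorial_odd (c : B) (n : ℕ) :
    c * ∏ j ∈ Finset.range n, (((2 * j + 3) * (2 * j + 2) * c ^ 2 : B) *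
      (4 * (2 * j + 1) * (2 * j + 2))) = c ^ (2 * n + 1) * 4 ^ n * (2 * n)! * (2 * n + 1)! := by
  induction n with
  | zero => simp
  | succ n ih =>
    rw [Finset.prod_range_succ, ← mul_assoc, ih, show 2 * (n + 1) + 1 = 2 * n + 1 + 1 + 1 by ring,
      show 2 * (n + 1) = 2 * n + 1 + 1 by ring]
    simp only [Nat.factorial_succ]
    push_cast
    ring

theorem prod_factorial_even (c : B) (n : ℕ) :
    (2 * c ^ 2) * ∏ j ∈ Finset.range n, (((2 * j + 4) * (2 * j + 3) * c ^ 2 : B) *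
      (4 * (2 * j + 2) * (2 * j + 3))) =
      c ^ (2 * n + 2) * 4 ^ n * (2 * n + 1)! * (2 * n + 2)! := by
  induction n with
  | zero => simp; ring
  | succ n ih =>
    rw [Finset.prod_range_succ, ← mul_assoc, ih,
      show 2 * (n + 1) + 2 = 2 * n + 1 + 1 + 1 + 1 by ring,
      show 2 * (n + 1) + 1 = 2 * n + 1 + 1 + 1 by ring, show 2 * n + 2 = 2 * n + 1 + 1 by ring]
    simp only [Nat.factorial_succ]
    push_cast
    ring

variable (ev : A →+* B)

/-- `ev` plays the role of evaluation at a zero of y, where the first integral equals (y')². -/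
theorem ev_iterate_derivation_pow (hb : D b = 0) (hy : D (D y) = b * y + 8 * y ^ 3)
    (h0 : ev y = 0) (k r : ℕ) :
    ev (D^[r + 2] (y ^ (k + 2))) =
      ((k + 2) * (k + 1) * ev (D y) ^ 2) * ev (D^[r] (y ^ k)) +
        ((k + 2) ^ 2 * ev b) * ev (D^[r] (y ^ (k + 2))) +
          (4 * (k + 2) * (k + 3)) * ev (D^[r] (y ^ (k + 4))) := by
  set e := D y ^ 2 - b * y ^ 2 - 4 * y ^ 4 with he
  have De : D e = 0 := derivation_first_integral D hb hy
  have eve : ev e = ev (D y) ^ 2 := by simp [he, h0]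
  have c1 : D (((k : A) + 2) * (k + 1) * e) = 0 := by
    have := D.map_natCast ((k + 2) * (k + 1))
    push_cast at this
    rw [D.leibniz, this, De]; simp
  have c2 : D (((k : A) + 2) ^ 2 * b) = 0 := by
    have := D.map_natCast ((k + 2) ^ 2)
    push_cast at this
    rw [D.leibniz, this, hb]; simp
  have c3 : D (4 * ((k : A) + 2) * (k + 3)) = 0 := by
    have := D.map_natCast (4 * (k + 2) * (k + 3))
    push_cast at this
    exact this
  rw [Function.iterate_add_apply _ _ 2, show D^[2] (y ^ (k + 2)) = D (D (y ^ (k + 2))) from rfl,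
    derivation_sq_pow D hy, ← he,
    derivation_iterate_add, derivation_iterate_add, derivation_iterate_const_mul D c1,
    derivation_iterate_const_mul D c2, derivation_iterate_const_mul D c3]
  simp only [map_add, map_mul, map_pow, map_natCast, map_ofNat, map_one, eve]

theorem det_hankel_odd_of_ode (hb : D b = 0) (hy : D (D y) = b * y + 8 * y ^ 3) (h0 : ev y = 0)
    (m : ℕ) :
    (Matrix.of fun i j : Fin m => ev (D^[2 * (i + j) + 1] y)).det =
      ∏ n ∈ Finset.range m, (ev (D y) ^ (2 * n + 1) * 4 ^ n * (2 * n)! * (2 * n + 1)!) := by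
  have step := ev_iterate_derivation_pow D ev hb hy h0
  have h8 : D (8 : A) = 0 := D.map_natCast 8
  have step0 : ∀ r, ev (D^[r + 2] y) = ev b * ev (D^[r] y) + 8 * ev (D^[r] (y ^ 3)) := by
    intro r
    rw [Function.iterate_add_apply _ _ 2, show D^[2] y = D (D y) from rfl, hy,
      derivation_iterate_add, derivation_iterate_const_mul D hb,
      derivation_iterate_const_mul D h8, map_add, map_mul, map_mul, map_ofNat]
  have key := det_hankel_tridiag (B := B) (c := ev (D y))
    (α := fun n => (2 * n + 3) * (2 * n + 2) * ev (D y) ^ 2)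
    (β := fun n => (2 * n + 1) ^ 2 * ev b)
    (γ := fun n => 4 * (2 * n + 1) * (2 * n + 2))
    (V := fun r n => ev (D^[2 * r + 1] (y ^ (2 * n + 1)))) (by simp)
    (fun n => by simp [D.leibniz_pow, h0]) (fun r => by
      have := step0 (2 * r + 1)
      simp only [show 2 * (r + 1) + 1 = 2 * r + 1 + 2 by ring, mul_zero, zero_add, pow_one, this,
        mul_one]
      norm_num) (fun r n => by
      have := step (2 * n + 1) (2 * r + 1)
      rw [show 2 * (r + 1) + 1 = 2 * r + 1 + 2 by ring,
        show 2 * (n + 1) + 1 = 2 * n + 1 + 2 by ring, this,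
        show 2 * (n + 2) + 1 = 2 * n + 1 + 4 by ring]
      push_cast
      ring) m
  simp only [mul_zero, zero_add, pow_one] at key
  rw [key]
  exact Finset.prod_congr rfl fun n _ => prod_factorial_odd _ n

/-- D²(y²) also contains a constant term. It gives the initial value 2(y')², and further derivatives
kill it, so the recurrence closes on y², y⁴, …. -/
theorem det_hankel_even_of_ode (hb : D b = 0) (hy : D (D y) = b * y + 8 * y ^ 3) (h0 : ev y = 0)
    (m : ℕ) :
    (Matrix.of fun i j : Fin m => ev (D^[2 * (i + j) + 2] (y ^ 2))).det =
      ∏ n ∈ Finset.range m, (ev (D y) ^ (2 * n + 2) * 4 ^ n * (2 * n + 1)! * (2 * n + 2)!) := by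
  have step := ev_iterate_derivation_pow D ev hb hy h0
  have D1 : ∀ r, D^[r + 1] (1 : A) = 0 := by
    intro r
    induction r with
    | zero => simp
    | succ r ih => rw [Function.iterate_succ_apply', ih, map_zero]
  have key := det_hankel_tridiag (B := B) (c := 2 * ev (D y) ^ 2)
    (α := fun n => (2 * n + 4) * (2 * n + 3) * ev (D y) ^ 2)
    (β := fun n => (2 * n + 2) ^ 2 * ev b)
    (γ := fun n => 4 * (2 * n + 2) * (2 * n + 3))
    (V := fun r n => ev (D^[2 * r + 2] (y ^ (2 * n + 2))))
    (by simpa [h0] using step 0 0)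
    (fun n => by
      have := step (2 * n + 2) 0
      simp only [Function.iterate_zero, id_eq, map_pow, h0] at this
      simpa [show 2 * (n + 1) + 2 = 2 * n + 2 + 2 by ring] using this) (fun r => by
      have := step 0 (2 * r + 2)
      rw [pow_zero, D1] at this
      simpa [show 2 * (r + 1) + 2 = 2 * r + 2 + 2 by ring] using this)
    (fun r n => by
      have := step (2 * n + 2) (2 * r + 2)
      rw [show 2 * (r + 1) + 2 = 2 * r + 2 + 2 by ring,
        show 2 * (n + 1) + 2 = 2 * n + 2 + 2 by ring, this,
        show 2 * (n + 2) + 2 = 2 * n + 2 + 4 by ring]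
      push_cast
      ring) m
  simp only [mul_zero, zero_add] at key
  rw [key]
  exact Finset.prod_congr rfl fun n _ => prod_factorial_even _ n

end Hankel

instance PowerSeries.instCharZero {E : Type*} [CommRing E] [CharZero E] :
    CharZero (PowerSeries E) :=
  ⟨fun a b h => by simpa using congrArg PowerSeries.constantCoeff h⟩

/-! ### Expansions of the terms of the elliptic sums and their addition formulas. -/

section EllipticTerms

open PowerSeries

variable {E : Type*} [CommRing E]

/-- The series `X + X³ + X⁵ + ⋯ = X / (1 - X²)`. -/
def oddGeom (E : Type*) [CommRing E] : E⟦X⟧ := mk fun k => if Odd k then 1 else 0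

theorem one_sub_sq_mul_oddGeom : (1 - X ^ 2) * oddGeom E = X := by
  ext n
  rw [sub_mul, one_mul, map_sub, mul_comm, oddGeom]
  rcases n with _ | _ | n
  · simp
  · simp [coeff_mul_X_pow']
  · rw [show n + 1 + 1 = n + 2 from rfl, coeff_mul_X_pow, coeff_mk, coeff_mk, coeff_X]
    simp [Nat.odd_add]

/-- The substitution `X ↦ x q ^ (m + 1)`. -/
noncomputable def substPow (x : E) (m : ℕ) : E⟦X⟧ →+* E⟦X⟧ :=
  (expand (m + 1) (Nat.succ_ne_zero m)).toRingHom.comp (rescale x)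

theorem coeff_substPow (x : E) (m : ℕ) (g : E⟦X⟧) (N : ℕ) :
    coeff N (substPow x m g) =
      if m + 1 ∣ N then x ^ (N / (m + 1)) * coeff (N / (m + 1)) g else 0 := by
  simp [substPow, coeff_expand, coeff_rescale]

theorem substPow_X (x : E) (m : ℕ) : substPow x m X = C x * X ^ (m + 1) := by
  rw [substPow, RingHom.comp_apply, rescale_X, map_mul]
  simp only [AlgHom.toRingHom_eq_coe, RingHom.coe_coe, expand_X, expand_C]

/-- The expansion in `q` of `y / (1 - y²)` at `y = x qⁿ`. -/
noncomputable def phi (x : Eˣ) : ℤ → E⟦X⟧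
  | .ofNat 0 => C (x * Ring.inverse (1 - (x : E) ^ 2))
  | .ofNat (m + 1) => substPow (x : E) m (oddGeom E)
  -- For n < 0 the expansion is in y⁻¹, using y/(1-y²) = -y⁻¹/(1-y⁻²).
  | .negSucc m => -substPow (↑x⁻¹ : E) m (oddGeom E)

/-- The expansion in `q` of `(1 + y²) / (1 - y²) - sign n` at `y = x qⁿ`. -/
noncomputable def rho (x : Eˣ) : ℤ → E⟦X⟧
  | .ofNat 0 => C ((1 + (x : E) ^ 2) * Ring.inverse (1 - (x : E) ^ 2))
  | .ofNat (m + 1) => 2 * substPow (x : E) m (X * oddGeom E)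
  | .negSucc m => -(2 * substPow (↑x⁻¹ : E) m (X * oddGeom E))

/-- The expansion in `q` of `(1 + y²) / (1 - y²)` at `y = x qⁿ`. -/
noncomputable def cot (x : Eˣ) (n : ℤ) : E⟦X⟧ := (n.sign : E⟦X⟧) + rho x n

theorem phi_one_neg (n : ℤ) : phi (1 : Eˣ) (-n) = -phi 1 n := by
  rcases n with (_ | m) | m
  · change phi 1 (Int.ofNat 0) = -phi 1 (Int.ofNat 0)
    simp [phi]
  · change phi 1 (Int.negSucc m) = _
    simp [phi]
  · change phi 1 (Int.ofNat (m + 1)) = _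
    simp [phi]

/-- At the pole y = 1, `Ring.inverse` takes its default value 0. Sums over all differences d may
thus include d = 0. -/
theorem phi_one_zero : phi (1 : Eˣ) 0 = 0 := by
  change phi 1 (Int.ofNat 0) = 0
  simp [phi]

theorem one_sub_mul_substPow (x : E) (m : ℕ) :
    (1 - (C x * X ^ (m + 1)) ^ 2) * substPow x m (oddGeom E) = C x * X ^ (m + 1) := by
  rw [← substPow_X, ← map_pow, ← map_one (substPow x m), ← map_sub, ← map_mul,
    one_sub_sq_mul_oddGeom]

section Domain

variable [IsDomain E]

/-- Away from the pole, the expansions in y and in y⁻¹ both represent one rational function of y, so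
identities can be checked in the fraction field. -/
theorem phi_cot_fraction (x : Eˣ) (n : ℤ) (h : n ≠ 0 ∨ IsUnit (1 - (x : E) ^ 2)) :
    ∃ t : FractionRing E⟦X⟧,
      t = algebraMap _ _ (C (x : E)) * (algebraMap E⟦X⟧ (FractionRing E⟦X⟧) X) ^ n ∧
      1 - t ^ 2 ≠ 0 ∧ algebraMap _ _ (phi x n) = t / (1 - t ^ 2) ∧
      algebraMap _ _ (cot x n) = (1 + t ^ 2) / (1 - t ^ 2) := by
  have inj : Function.Injective (algebraMap E⟦X⟧ (FractionRing E⟦X⟧)) :=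
    IsFractionRing.injective _ _
  set a := algebraMap E⟦X⟧ (FractionRing E⟦X⟧) with ha
  have aX : a X ≠ 0 := by
    rw [Ne, map_eq_zero_iff a inj]; exact X_ne_zero
  have key : ∀ (z : E) (m : ℕ), 1 - (a (C z) * a X ^ (m + 1)) ^ 2 ≠ 0 ∧
      a (substPow z m (oddGeom E)) =
        a (C z) * a X ^ (m + 1) / (1 - (a (C z) * a X ^ (m + 1)) ^ 2) := by
    intro z m
    have h1 : 1 - (a (C z) * a X ^ (m + 1)) ^ 2 ≠ 0 := by
      have : (1 - (C z * X ^ (m + 1)) ^ 2 : E⟦X⟧) ≠ 0 := by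
        intro h0
        have := congrArg constantCoeff h0
        simp at this
      rw [Ne, ← map_eq_zero_iff a inj] at this
      simpa using this
    refine ⟨h1, ?_⟩
    rw [eq_div_iff h1, mul_comm]
    have := congrArg a (one_sub_mul_substPow z m)
    simpa using this
  refine ⟨_, rfl, ?_⟩
  rcases n with (_ | m) | m
  · rcases h with h | h
    · exact absurd rfl h
    have hi : a (C (1 - (x : E) ^ 2)) * a (C (Ring.inverse (1 - (x : E) ^ 2))) = 1 := by
      rw [← map_mul, ← map_mul, Ring.mul_inverse_cancel _ h, map_one, map_one]
    have hi' : a (C (1 - (x : E) ^ 2)) = 1 - a (C (x : E)) ^ 2 := by simp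
    rw [hi'] at hi
    have h1 := left_ne_zero_of_mul_eq_one hi
    have e : Int.ofNat 0 = 0 := rfl
    simp only [phi, cot, rho, e, Int.sign_zero, zpow_zero, mul_one, Int.cast_zero, zero_add, map_mul,
      map_add, map_one, map_pow]
    refine ⟨h1, ?_, ?_⟩
    · rw [eq_div_iff h1, mul_assoc, mul_comm _ (1 - _), hi, mul_one]
    · rw [eq_div_iff h1, mul_assoc, mul_comm _ (1 - _), hi, mul_one]
  · obtain ⟨h1, h2⟩ := key x m
    have e : a X ^ (Int.ofNat (m + 1)) = a X ^ (m + 1) := zpow_natCast _ _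
    have hs : (Int.ofNat (m + 1)).sign = 1 := rfl
    rw [e]
    refine ⟨h1, h2, ?_⟩
    rw [cot, rho, hs, map_mul, map_add, map_mul, map_mul, substPow_X, map_mul, h2, map_pow]
    simp only [Int.cast_one, map_one, map_ofNat]
    generalize a (C (x : E)) * a X ^ (m + 1) = p at h1 ⊢
    field_simp
    ring
  · obtain ⟨h1, h2⟩ := key (↑x⁻¹ : E) m
    have e : a X ^ (Int.negSucc m) = (a X ^ (m + 1))⁻¹ := zpow_negSucc _ _
    have hx : a (C (x : E)) * a (C (↑x⁻¹ : E)) = 1 := by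
      rw [← map_mul, ← map_mul, Units.mul_inv, map_one, map_one]
    have hx0 := left_ne_zero_of_mul_eq_one hx
    have hx1 : a (C (↑x⁻¹ : E)) = (a (C (x : E)))⁻¹ := eq_inv_of_mul_eq_one_right hx
    rw [e]
    rw [hx1] at h1 h2
    have hs : (Int.negSucc m).sign = -1 := rfl
    set p := a (C (x : E)) * (a X ^ (m + 1))⁻¹ with hp
    have hp0 : p ≠ 0 := mul_ne_zero hx0 (inv_ne_zero (pow_ne_zero _ aX))
    have hpi : (a (C (x : E)))⁻¹ * a X ^ (m + 1) = p⁻¹ := by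
      rw [hp, mul_inv, inv_inv]
    rw [hpi] at h1 h2
    have h3 : 1 - p ^ 2 ≠ 0 := by
      intro h0
      apply h1
      rw [inv_pow, ← sub_eq_zero.mp h0]; simp
    have h4 : p ^ 2 - 1 ≠ 0 := by
      intro h0; apply h3; linear_combination -h0
    refine ⟨h3, ?_, ?_⟩
    · rw [phi, map_neg, h2]
      field_simp
      ring
    · rw [cot, rho, hs, map_mul, map_add, map_neg, map_mul, map_mul, substPow_X, map_mul, h2, hx1,
        map_pow, hpi]
      simp only [Int.cast_one, map_one, map_ofNat, Int.cast_neg, map_neg]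
      field_simp
      ring

/-- With y = e^s, `phi` is -1/(2 sinh s) and `cot` is -coth s; the first identity is csch s csch t =
csch(t-s)(coth s - coth t), and the second is another form of it. -/
theorem phi_mul_phi (x : Eˣ) (a b : ℤ) (ha : a ≠ 0 ∨ IsUnit (1 - (x : E) ^ 2))
    (hb : b ≠ 0 ∨ IsUnit (1 - (x : E) ^ 2)) (hab : b - a ≠ 0) :
    2 * phi x a * phi x b = phi 1 (b - a) * (cot x a - cot x b) ∧
    -2 * phi 1 (b - a) * phi x b = phi x a * (cot x b - cot 1 (b - a)) := by
  have inj : Function.Injective (algebraMap E⟦X⟧ (FractionRing E⟦X⟧)) :=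
    IsFractionRing.injective _ _
  obtain ⟨t, ht, t1, t2, t3⟩ := phi_cot_fraction x a ha
  obtain ⟨u, hu, u1, u2, u3⟩ := phi_cot_fraction x b hb
  obtain ⟨v, hv, v1, v2, v3⟩ := phi_cot_fraction (1 : Eˣ) (b - a) (Or.inl hab)
  have aX : algebraMap E⟦X⟧ (FractionRing E⟦X⟧) X ≠ 0 := by
    rw [Ne, map_eq_zero_iff _ inj]; exact X_ne_zero
  have huv : u = t * v := by
    rw [hu, ht, hv, mul_mul_mul_comm, ← zpow_add₀ aX]
    simp
  subst huv
  have u4 : 1 - t ^ 2 * v ^ 2 ≠ 0 := by rwa [← mul_pow]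
  have u5 : 1 - v ^ 2 * t ^ 2 ≠ 0 := by rwa [mul_comm]
  rw [mul_pow] at u2 u3
  constructor
  · apply inj
    simp only [map_mul, map_sub, map_ofNat, t2, t3, u2, u3, v2]
    field_simp
    ring
  · apply inj
    simp only [map_mul, map_sub, map_neg, map_ofNat, t2, u2, u3, v2, v3]
    field_simp
    ring

/-- `cot` is not summable over n, so it is split into its limit `sign` and the summable remainder
`rho`. -/
theorem two_mul_phi_mul_phi (x : Eˣ) (a d : ℤ) (ha : a ≠ 0 ∨ IsUnit (1 - (x : E) ^ 2))
    (hb : a + d ≠ 0 ∨ IsUnit (1 - (x : E) ^ 2)) :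
    2 * (phi x a * phi x (a + d)) = (if d = 0 then 2 * phi x a ^ 2 else 0) +
      (phi 1 d * ((a.sign - (a + d).sign : ℤ) : E⟦X⟧) + phi 1 d * rho x a -
        phi 1 d * rho x (a + d)) := by
  rcases eq_or_ne d 0 with rfl | hd
  · rw [phi_one_zero, add_zero, if_pos rfl]; ring
  · have h := (phi_mul_phi x a (a + d) ha hb (by simpa using hd)).1
    rw [add_sub_cancel_left] at h
    rw [if_neg hd, ← mul_assoc, h, cot, cot]
    push_cast
    ring

theorem two_mul_phi_sq_mul_phi (x : Eˣ) (a d : ℤ) (ha : a ≠ 0) (hb : a + d ≠ 0) :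
    2 * (phi x a ^ 2 * phi x (a + d)) = (if d = 0 then 2 * phi x a ^ 3 else 0) +
      (phi 1 d * (phi x a * cot x a) - phi 1 d * cot 1 d * phi x a +
        2 * phi 1 d ^ 2 * phi x (a + d)) := by
  rcases eq_or_ne d 0 with rfl | hd
  · rw [phi_one_zero, add_zero, if_pos rfl]; ring
  · obtain ⟨h1, h2⟩ := phi_mul_phi x a (a + d) (Or.inl ha) (Or.inl hb) (by simpa using hd)
    rw [add_sub_cancel_left] at h1 h2
    rw [if_neg hd]
    linear_combination phi x a * h1 + phi 1 d * h2

end Domain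

end EllipticTerms

/-! ### Products of sums over translates, as double sums. -/

section Summation

open PowerSeries
open scoped PowerSeries.WithPiTopology

variable {E : Type*} [CommRing E] {ι κ : Type*}

theorem hasSum_congr_fun {α : Type*} [AddCommMonoid α] [TopologicalSpace α] {f g : ι → α} {a : α}
    (h : ∀ i, f i = g i) : HasSum f a ↔ HasSum g a := by
  rw [funext h]

/-- A family of power series in which every coefficient vanishes for all but finitely many
members. -/
def IsSmall (f : ι → E⟦X⟧) : Prop := ∀ N, {i | coeff N (f i) ≠ 0}.Finite

theorem IsSmall.mul_right {f : ι → E⟦X⟧} (hf : IsSmall f) (g : ι → E⟦X⟧) :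
    IsSmall fun i => f i * g i := by
  intro N
  refine ((Finset.range (N + 1)).finite_toSet.biUnion fun n _ => hf n).subset ?_
  intro i hi
  by_contra h
  simp only [Set.mem_iUnion, not_exists] at h
  apply hi
  rw [coeff_mul]
  refine Finset.sum_eq_zero fun p hp => ?_
  have := h p.1 (by rw [Finset.HasAntidiagonal.mem_antidiagonal] at hp; simp; omega)
  rw [Set.mem_ofPred_eq, not_not] at this
  rw [this, zero_mul]

theorem IsSmall.mul_prod {f : ι → E⟦X⟧} {g : κ → E⟦X⟧} (hf : IsSmall f) (hg : IsSmall g) :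
    IsSmall fun p : ι × κ => f p.1 * g p.2 := by
  intro N
  refine (((Finset.range (N + 1)).finite_toSet.biUnion fun n _ => hf n).prod
    ((Finset.range (N + 1)).finite_toSet.biUnion fun n _ => hg n)).subset ?_
  rintro ⟨i, j⟩ hij
  have : ∃ p ∈ Finset.HasAntidiagonal.antidiagonal N, coeff p.1 (f i) * coeff p.2 (g j) ≠ 0 := by
    by_contra h
    push Not at h
    exact hij (by rw [coeff_mul]; exact Finset.sum_eq_zero h)
  obtain ⟨p, hp, h⟩ := this
  constructor
  · exact Set.mem_biUnion (x := p.1)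
      (by rw [Finset.HasAntidiagonal.mem_antidiagonal] at hp; simp; omega) (left_ne_zero_of_mul h)
  · exact Set.mem_biUnion (x := p.2)
      (by rw [Finset.HasAntidiagonal.mem_antidiagonal] at hp; simp; omega) (right_ne_zero_of_mul h)

theorem coeff_phi_eq_zero (x : Eˣ) {n : ℤ} {N : ℕ} (h : (N : ℤ) < |n|) :
    coeff N (phi x n) = 0 ∧ coeff N (rho x n) = 0 := by
  have key : ∀ (z : E) (m : ℕ), N < m + 1 → coeff N (substPow z m (oddGeom E)) = 0 ∧
      coeff N (substPow z m (X * oddGeom E)) = 0 := by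
    intro z m hm
    rw [coeff_substPow, coeff_substPow]
    by_cases hd : m + 1 ∣ N
    · obtain rfl := Nat.eq_zero_of_dvd_of_lt hd hm
      simp [oddGeom]
    · simp [hd]
  have h2 : (2 : E⟦X⟧) = C 2 := (map_ofNat C 2).symm
  rcases n with (_ | m) | m
  · exact absurd h (by change ¬ ((N : ℤ) < |0|); simp)
  · obtain ⟨k1, k2⟩ := key x m (by
      rw [Int.ofNat_eq_natCast, abs_of_nonneg (by positivity)] at h; omega)
    exact ⟨k1, by rw [rho, h2, coeff_C_mul, k2, mul_zero]⟩
  · obtain ⟨k1, k2⟩ := key (↑x⁻¹ : E) m (by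
      rw [abs_of_neg (Int.negSucc_lt_zero m)] at h; omega)
    exact ⟨by rw [phi, map_neg, k1, neg_zero], by rw [rho, h2, map_neg, coeff_C_mul, k2]; simp⟩

theorem isSmall_phi (x : Eˣ) {u : ι → ℤ} (hu : Function.Injective u) :
    IsSmall fun i => phi x (u i) := by
  intro N
  refine ((Set.finite_Icc (-(N : ℤ)) N).preimage hu.injOn).subset fun i hi => ?_
  by_contra h
  rw [Set.mem_preimage, Set.mem_Icc, ← abs_le, not_le] at h
  exact hi (coeff_phi_eq_zero x h).1

theorem isSmall_rho (x : Eˣ) {u : ι → ℤ} (hu : Function.Injective u) :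
    IsSmall fun i => rho x (u i) := by
  intro N
  refine ((Set.finite_Icc (-(N : ℤ)) N).preimage hu.injOn).subset fun i hi => ?_
  by_contra h
  rw [Set.mem_preimage, Set.mem_Icc, ← abs_le, not_le] at h
  exact hi (coeff_phi_eq_zero x h).2

/-- Telescoping: raising d by 2 amounts to shifting j by 1, which leaves the base cases d = 0 and d
= 1. -/
theorem hasSum_sign_sub_sign (d : ℤ) :
    HasSum (fun j : ℤ => (2 * j + 1).sign - (2 * j + 1 + d).sign) (-d) := by
  have h2 : HasSum (fun j : ℤ => (2 * j + 1).sign - (2 * j + 1 + 2).sign) (-2) := by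
    refine hasSum_single (f := fun j : ℤ => (2 * j + 1).sign - (2 * j + 1 + 2).sign) (-1)
      fun j hj => ?_
    rcases lt_or_gt_of_ne hj with h | h
    · rw [Int.sign_eq_neg_one_of_neg (by omega), Int.sign_eq_neg_one_of_neg (by omega)]; rfl
    · rw [Int.sign_eq_one_of_pos (by omega), Int.sign_eq_one_of_pos (by omega)]; rfl
  have h1 : HasSum (fun j : ℤ => (2 * j + 1).sign - (2 * j + 1 + 1).sign) (-1) := by
    refine hasSum_single (f := fun j : ℤ => (2 * j + 1).sign - (2 * j + 1 + 1).sign) (-1)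
      fun j hj => ?_
    rcases lt_or_gt_of_ne hj with h | h
    · rw [Int.sign_eq_neg_one_of_neg (by omega), Int.sign_eq_neg_one_of_neg (by omega)]; rfl
    · rw [Int.sign_eq_one_of_pos (by omega), Int.sign_eq_one_of_pos (by omega)]; rfl
  have step : ∀ d : ℤ, HasSum (fun j : ℤ => (2 * j + 1).sign - (2 * j + 1 + d).sign) (-d) ↔
      HasSum (fun j : ℤ => (2 * j + 1).sign - (2 * j + 1 + (d + 2)).sign) (-(d + 2)) := by
    intro d
    rw [← (Equiv.addRight (1 : ℤ)).hasSum_iff]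
    have e : (fun j : ℤ => (2 * j + 1).sign - (2 * j + 1 + (d + 2)).sign) = fun j =>
        ((fun j : ℤ => (2 * j + 1).sign - (2 * j + 1 + d).sign) ∘ Equiv.addRight (1 : ℤ)) j +
          ((2 * j + 1).sign - (2 * j + 1 + 2).sign) := by
      funext j
      simp only [Function.comp, Equiv.coe_addRight]
      rw [show 2 * (j + 1) + 1 = 2 * j + 1 + 2 by ring,
        show 2 * j + 1 + (d + 2) = 2 * j + 1 + 2 + d by ring]
      ring
    constructor
    · intro h
      rw [e, neg_add]
      exact h.add h2
    · intro h
      rw [e, neg_add] at h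
      have h3 := h.sub h2
      rw [add_sub_cancel_right] at h3
      exact (hasSum_congr_fun fun j => add_sub_cancel_right _ _).mp h3
  obtain ⟨e, rfl | rfl⟩ := Int.even_or_odd' d
  · induction e using Int.induction_on with
    | zero => simp
    | succ i ih => rw [mul_add, mul_one]; exact (step _).1 ih
    | pred i ih => rw [step, show 2 * (-(i : ℤ) - 1) + 2 = 2 * -i by ring]; exact ih
  · induction e using Int.induction_on with
    | zero => simpa using h1
    | succ i ih =>
      rw [show 2 * ((i : ℤ) + 1) + 1 = 2 * i + 1 + 2 by ring]; exact (step _).1 ih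
    | pred i ih =>
      rw [step, show 2 * (-(i : ℤ) - 1) + 1 + 2 = 2 * -i + 1 by ring]; exact ih

variable [TopologicalSpace E]

theorem IsSmall.summable {f : ι → E⟦X⟧} (hf : IsSmall f) : Summable f :=
  (WithPiTopology.summable_iff_summable_coeff E).mpr fun N => summable_of_hasFiniteSupport (hf N)

theorem hasSum_cast_sign_sub_sign (d : ℤ) :
    HasSum (fun j : ℤ => (((2 * j + 1).sign - (2 * j + 1 + d).sign : ℤ) : E⟦X⟧))
      ((-d : ℤ) : E⟦X⟧) :=
  (hasSum_sign_sub_sign d).map (Int.castAddHom E⟦X⟧) continuous_of_discreteTopology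

variable [DiscreteTopology E] [IsDomain E] [CharZero E]

/-- The reflection e ↦ -p - e reverses the sign of every term, so the sum is its own negative. -/
theorem hasSum_phi_one (p : ℤ) : HasSum (fun e : ℤ => phi (1 : Eˣ) (2 * e + p)) 0 := by
  have inj : Function.Injective fun e : ℤ => 2 * e + p := fun a b h => by
    simp only at h; omega
  obtain ⟨a, ha⟩ := (isSmall_phi (1 : Eˣ) inj).summable
  have h := (Equiv.subLeft (-p)).hasSum_iff.mpr ha
  have e : ((fun e : ℤ => phi (1 : Eˣ) (2 * e + p)) ∘ Equiv.subLeft (-p)) =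
      fun e => -phi (1 : Eˣ) (2 * e + p) := by
    funext j
    simp only [Function.comp, Equiv.subLeft_apply]
    rw [← phi_one_neg]
    congr 1
    ring
  rw [e] at h
  have h0 : a = -a := h.unique ha.neg
  have : a = 0 := by
    have : (2 : E⟦X⟧) * a = 0 := by linear_combination h0
    have h2 : (2 : E⟦X⟧) ≠ 0 := by
      intro h
      have := congrArg constantCoeff h
      rw [map_ofNat, map_zero] at this
      exact two_ne_zero this
    exact (mul_eq_zero.mp this).resolve_left h2
  rwa [this] at ha

/-- The change of variables `(e, j) ↦ (j, j + e)`. -/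
def shearEquiv : ℤ × ℤ ≃ ℤ × ℤ where
  toFun q := (q.2, q.2 + q.1)
  invFun q := (q.2 - q.1, q.1)
  left_inv q := by simp
  right_inv q := by simp

/-- Pairs are indexed by their difference 2e+p and a base point, and the addition formula is applied
to each. The diagonal gives 2W and the `sign` parts telescope to -k. The `rho` parts factor through
`hasSum_phi_one` and vanish. For p = 1 the index 2j+2 reaches 0, so 1 - x² must be invertible. -/
theorem two_mul_phiSum_mul_phiSum (x : Eˣ) (p : ℤ)
    (hp : p = 0 ∨ p = 1 ∧ IsUnit (1 - (x : E) ^ 2)) {S S' W k : E⟦X⟧}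
    (hS : HasSum (fun j : ℤ => phi x (2 * j + 1)) S)
    (hS' : HasSum (fun j : ℤ => phi x (2 * j + 1 + p)) S')
    (hW : HasSum (fun j : ℤ => if p = 0 then phi x (2 * j + 1) ^ 2 else 0) W)
    (hk : HasSum (fun e : ℤ => ((2 * e + p : ℤ) : E⟦X⟧) * phi 1 (2 * e + p)) k) :
    2 * (S * S') = 2 * W - k := by
  have inj1 : Function.Injective fun j : ℤ => 2 * j + 1 := fun a b h => by
    simp only at h; omega
  have injp : Function.Injective fun j : ℤ => 2 * j + p := fun a b h => by
    simp only at h; omega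
  have inj1p : Function.Injective fun j : ℤ => 2 * j + 1 + p := fun a b h => by
    simp only at h; omega
  have hL := shearEquiv.hasSum_iff.mpr ((hS.mul hS'
    ((isSmall_phi x inj1).mul_prod (isSmall_phi x inj1p)).summable).mul_left 2)
  have hδ : HasSum (fun q : ℤ × ℤ => if 2 * q.1 + p = 0 then 2 * phi x (2 * q.2 + 1) ^ 2 else 0)
      (2 * W) := by
    have inj0 : Function.Injective fun j : ℤ => ((0, j) : ℤ × ℤ) := fun a b h => by
      simpa using h
    rw [← inj0.hasSum_iff]
    · refine (hasSum_congr_fun fun j => ?_).mp (hW.mul_left 2)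
      simp
    · rintro ⟨e, j⟩ hq
      have : e ≠ 0 := fun h => hq ⟨j, by simp [h]⟩
      rw [if_neg (by rcases hp with rfl | ⟨rfl, -⟩ <;> omega)]
  have hτ := hasSum_phi_one (E := E) p
  have hsg : HasSum (fun q : ℤ × ℤ => phi 1 (2 * q.1 + p) *
      (((2 * q.2 + 1).sign - (2 * q.2 + 1 + (2 * q.1 + p)).sign : ℤ) : E⟦X⟧)) (-k) := by
    -- A nonzero N-th coefficient forces |2e+p| ≤ N, and the signs can differ only if 2j+1 is within
    -- that distance of 0.
    have hsm : IsSmall fun q : ℤ × ℤ => phi (1 : Eˣ) (2 * q.1 + p) *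
        (((2 * q.2 + 1).sign - (2 * q.2 + 1 + (2 * q.1 + p)).sign : ℤ) : E⟦X⟧) := by
      intro N
      refine (((Set.finite_Icc (-(N : ℤ)) N).preimage injp.injOn).prod
        ((Set.finite_Icc (-(N : ℤ)) N).preimage inj1.injOn)).subset ?_
      rintro ⟨e, j⟩ h
      simp only [Set.mem_ofPred_eq] at h
      rw [← map_intCast (C (R := E)), coeff_mul_C] at h
      have h1 : |2 * e + p| ≤ N := by
        by_contra h'
        exact left_ne_zero_of_mul h (coeff_phi_eq_zero 1 (not_le.mp h')).1
      have h2 : (2 * j + 1).sign - (2 * j + 1 + (2 * e + p)).sign ≠ 0 := by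
        intro h'
        exact right_ne_zero_of_mul h (by rw [h', Int.cast_zero])
      rw [abs_le] at h1
      refine ⟨h1, ?_⟩
      simp only [Set.mem_preimage, Set.mem_Icc]
      by_contra h3
      apply h2
      rcases lt_or_ge (2 * j + 1) 0 with h4 | h4
      · rw [Int.sign_eq_neg_one_of_neg h4, Int.sign_eq_neg_one_of_neg (by omega)]; rfl
      · rw [Int.sign_eq_one_of_pos (by omega), Int.sign_eq_one_of_pos (by omega)]; rfl
    obtain ⟨T, hT⟩ := hsm.summable
    have hfib : ∀ e : ℤ, HasSum (fun j : ℤ => phi (1 : Eˣ) (2 * e + p) *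
        (((2 * j + 1).sign - (2 * j + 1 + (2 * e + p)).sign : ℤ) : E⟦X⟧))
        (phi (1 : Eˣ) (2 * e + p) * ((-(2 * e + p) : ℤ) : E⟦X⟧)) := fun e =>
      (hasSum_cast_sign_sub_sign (E := E) (2 * e + p)).mul_left (phi (1 : Eˣ) (2 * e + p))
    have h1 := HasSum.prod_fiberwise hT hfib
    have h2 : T = -k := by
      refine h1.unique ?_
      refine (hasSum_congr_fun fun e => ?_).mp hk.neg
      push_cast
      ring
    rwa [h2] at hT
  have hρ1 : HasSum (fun q : ℤ × ℤ => phi (1 : Eˣ) (2 * q.1 + p) * rho x (2 * q.2 + 1)) 0 := by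
    obtain ⟨R, hR⟩ := (isSmall_rho x inj1).summable
    simpa using hτ.mul hR ((isSmall_phi 1 injp).mul_prod (isSmall_rho x inj1)).summable
  -- Shifting j by e for each fixed e separates the two variables again.
  have hρ2 : HasSum (fun q : ℤ × ℤ => phi (1 : Eˣ) (2 * q.1 + p) *
      rho x (2 * q.2 + 1 + (2 * q.1 + p))) 0 := by
    obtain ⟨R, hR⟩ := (isSmall_rho x inj1p).summable
    have h := hτ.mul hR ((isSmall_phi 1 injp).mul_prod (isSmall_rho x inj1p)).summable
    rw [zero_mul] at h
    refine (hasSum_congr_fun fun q => ?_).mp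
      ((Equiv.prodShear (Equiv.refl ℤ) fun e : ℤ => Equiv.addRight e).hasSum_iff.mpr h)
    simp only [Function.comp, Equiv.prodShear_apply, Equiv.refl_apply, Equiv.coe_addRight]
    rw [show 2 * (q.2 + q.1) + 1 + p = 2 * q.2 + 1 + (2 * q.1 + p) by ring]
  have hR := hδ.add ((hsg.add hρ1).sub hρ2)
  have e : 2 * (S * S') = 2 * W + (-k + 0 - 0) := by
    refine hL.unique ?_
    refine (hasSum_congr_fun fun q => ?_).mpr hR
    have hb : 2 * q.2 + 1 + (2 * q.1 + p) ≠ 0 ∨ IsUnit (1 - (x : E) ^ 2) := by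
      rcases hp with rfl | ⟨rfl, h⟩
      · left; omega
      · exact Or.inr h
    rw [← two_mul_phi_mul_phi x (2 * q.2 + 1) (2 * q.1 + p) (Or.inl (by omega)) hb]
    simp only [Function.comp, shearEquiv, Equiv.coe_fn_mk]
    rw [show 2 * (q.2 + q.1) + 1 + p = 2 * q.2 + 1 + (2 * q.1 + p) by ring]
  rw [e]
  ring

/-- The same method in degree three. `phi` times `cot` is already summable, so no sign correction is
needed, and its contribution vanishes by `hasSum_phi_one`. -/
theorem two_mul_phiSqSum_mul_phiSum (x : Eˣ) {S W T k : E⟦X⟧}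
    (hS : HasSum (fun j : ℤ => phi x (2 * j + 1)) S)
    (hW : HasSum (fun j : ℤ => phi x (2 * j + 1) ^ 2) W)
    (hT : HasSum (fun j : ℤ => phi x (2 * j + 1) ^ 3) T)
    (hk : HasSum (fun e : ℤ => 2 * phi (1 : Eˣ) (2 * e) ^ 2 - phi 1 (2 * e) * cot 1 (2 * e)) k) :
    2 * (W * S) = 2 * T + k * S := by
  have inj1 : Function.Injective fun j : ℤ => 2 * j + 1 := fun a b h => by
    simp only at h; omega
  have inj2 : Function.Injective fun j : ℤ => 2 * j := fun a b h => by
    simp only at h; omega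
  have small2 : IsSmall fun j : ℤ => phi x (2 * j + 1) ^ 2 := by
    simpa only [sq] using (isSmall_phi x inj1).mul_right _
  have hL := shearEquiv.hasSum_iff.mpr ((hW.mul hS
    (small2.mul_prod (isSmall_phi x inj1)).summable).mul_left 2)
  have hδ : HasSum (fun q : ℤ × ℤ => if 2 * q.1 = 0 then 2 * phi x (2 * q.2 + 1) ^ 3 else 0)
      (2 * T) := by
    have inj0 : Function.Injective fun j : ℤ => ((0, j) : ℤ × ℤ) := fun a b h => by
      simpa using h
    rw [← inj0.hasSum_iff]
    · refine (hasSum_congr_fun fun j => ?_).mp (hT.mul_left 2)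
      simp
    · rintro ⟨e, j⟩ hq
      have : e ≠ 0 := fun h => hq ⟨j, by simp [h]⟩
      rw [if_neg (by omega)]
  have hτ : HasSum (fun e : ℤ => phi (1 : Eˣ) (2 * e)) 0 := by
    simpa using hasSum_phi_one (E := E) 0
  have h1 : HasSum (fun q : ℤ × ℤ => phi (1 : Eˣ) (2 * q.1) *
      (phi x (2 * q.2 + 1) * cot x (2 * q.2 + 1))) 0 := by
    have sm := (isSmall_phi x inj1).mul_right fun j => cot x (2 * j + 1)
    obtain ⟨R, hR⟩ := sm.summable
    simpa using hτ.mul hR ((isSmall_phi 1 inj2).mul_prod sm).summable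
  have sK := (isSmall_phi (1 : Eˣ) inj2).mul_right fun j => cot 1 (2 * j)
  have sQ := (isSmall_phi (1 : Eˣ) inj2).mul_right fun j => 2 * phi 1 (2 * j)
  obtain ⟨k1, hk1⟩ := sK.summable
  obtain ⟨k2, hk2⟩ := sQ.summable
  have h2 := hk1.mul hS (sK.mul_prod (isSmall_phi x inj1)).summable
  have h3 : HasSum (fun q : ℤ × ℤ => 2 * phi (1 : Eˣ) (2 * q.1) ^ 2 *
      phi x (2 * q.2 + 1 + 2 * q.1)) (k2 * S) := by
    have h := hk2.mul hS (sQ.mul_prod (isSmall_phi x inj1)).summable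
    refine (hasSum_congr_fun fun q => ?_).mp
      ((Equiv.prodShear (Equiv.refl ℤ) fun e : ℤ => Equiv.addRight e).hasSum_iff.mpr h)
    simp only [Function.comp, Equiv.prodShear_apply, Equiv.refl_apply, Equiv.coe_addRight]
    rw [show 2 * (q.2 + q.1) + 1 = 2 * q.2 + 1 + 2 * q.1 by ring]
    ring
  have hkk : k = k2 - k1 := by
    refine hk.unique ?_
    refine (hasSum_congr_fun fun e => ?_).mp (hk2.sub hk1)
    ring
  have e : 2 * (W * S) = 2 * T + (0 - k1 * S + k2 * S) := by
    refine hL.unique ?_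
    refine (hasSum_congr_fun fun q => ?_).mpr (hδ.add ((h1.sub h2).add h3))
    rw [← two_mul_phi_sq_mul_phi x (2 * q.2 + 1) (2 * q.1) (by omega) (by omega)]
    simp only [Function.comp, shearEquiv, Equiv.coe_fn_mk]
    rw [show 2 * (q.2 + q.1) + 1 = 2 * q.2 + 1 + 2 * q.1 by ring]
  rw [e, hkk]
  ring

end Summation

/-! ### Evaluation of the sums over translates as Lambert series. -/

section Lambert

open PowerSeries
open scoped PowerSeries.WithPiTopology

variable {E : Type*} [CommRing E]

/-- The series `∑_{k, l ≥ 1} w k l q^{kl}`. -/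
def lambert (w : ℕ → ℕ → E) : E⟦X⟧ := mk fun N => ∑ p ∈ N.divisorsAntidiagonal, w p.1 p.2

theorem lambert_add (v w : ℕ → ℕ → E) :
    lambert (fun k l => v k l + w k l) = lambert v + lambert w := by
  ext N; simp [lambert, Finset.sum_add_distrib]

theorem lambert_congr {v w : ℕ → ℕ → E} (h : ∀ k l, v k l = w k l) : lambert v = lambert w := by
  rw [show v = w from funext fun k => funext fun l => h k l]

theorem coeff_oddGeom_sq (k : ℕ) :
    coeff k (oddGeom E ^ 2) = if Even k then ((k / 2 : ℕ) : E) else 0 := by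
  have h : oddGeom E ^ 2 = mk fun k => if Even k then ((k / 2 : ℕ) : E) else 0 := by
    have hu : IsUnit ((1 - X ^ 2) : E⟦X⟧) := by simp [isUnit_iff_constantCoeff]
    apply hu.mul_left_cancel
    rw [sq (oddGeom E), ← mul_assoc, one_sub_sq_mul_oddGeom]
    ext n
    rw [sub_mul, one_mul, map_sub, mul_comm X, mul_comm (X ^ 2)]
    rcases n with _ | _ | n
    · simp
    · simp [coeff_mul_X_pow', oddGeom]
    · rw [show n + 1 + 1 = n + 2 from rfl, coeff_mul_X_pow, show n + 2 = (n + 1) + 1 from rfl,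
        coeff_succ_mul_X, coeff_mk, coeff_mk, oddGeom, coeff_mk]
      rcases Nat.even_or_odd n with h | h
      · have h1 : Even (n + 1 + 1) := by simpa [Nat.even_add_one] using h
        rw [if_pos h.add_one, if_pos h1, if_pos h, show (n + 1 + 1) / 2 = n / 2 + 1 by omega]
        push_cast; ring
      · have h0 : ¬ Even n := by simpa using h
        have h1 : ¬ Even (n + 1 + 1) := by simpa [Nat.even_add_one] using h
        have h2 : ¬ Odd (n + 1) := by simpa [Nat.odd_add_one] using h
        rw [if_neg h2, if_neg h1, if_neg h0, sub_zero]
  rw [h, coeff_mk]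

/-- This is (y d/dy)² applied to g = y/(1-y²), which gives g + 8g³. Summed over translates it
supplies the cubic term of the differential equation. -/
theorem oddGeom_ode :
    (mk fun k => if Odd k then (k : E) ^ 2 else 0 : E⟦X⟧) = oddGeom E + 8 * oddGeom E ^ 3 := by
  have hu : IsUnit ((1 - X ^ 2) ^ 3 : E⟦X⟧) := by simp [isUnit_iff_constantCoeff]
  apply hu.mul_left_cancel
  have e : (1 - X ^ 2) ^ 3 * (oddGeom E + 8 * oddGeom E ^ 3) = X * (1 - X ^ 2) ^ 2 + 8 * X ^ 3 := by
    have := one_sub_sq_mul_oddGeom (E := E)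
    calc _ = ((1 - X ^ 2) * oddGeom E) * (1 - X ^ 2) ^ 2 + 8 * ((1 - X ^ 2) * oddGeom E) ^ 3 := by
          ring
      _ = _ := by rw [this]
  rw [e]
  set g : E⟦X⟧ := mk fun k => if Odd k then (k : E) ^ 2 else 0 with hg
  have e1 : X * (1 - X ^ 2) ^ 2 + 8 * X ^ 3 = X + X ^ 3 * C (6 : E) + X ^ 5 := by
    have h6 : (C 6 : E⟦X⟧) = 6 := map_ofNat C 6
    rw [h6]; ring
  have e2 : (1 - X ^ 2) ^ 3 * g = g - C (3 : E) * (g * X ^ 2) + C (3 : E) * (g * X ^ 4) - g * X ^ 6 := by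
    have h3 : (C 3 : E⟦X⟧) = 3 := map_ofNat C 3
    rw [h3]; ring
  rw [e1, e2]
  ext n
  simp only [map_add, map_sub, coeff_C_mul, coeff_mul_C, coeff_mul_X_pow', coeff_X_pow, coeff_X, hg, coeff_mk]
  by_cases hn : n < 6
  · interval_cases n <;> simp <;> norm_num
  · obtain ⟨m, rfl⟩ : ∃ m, n = m + 6 := ⟨n - 6, by omega⟩
    rw [if_pos (show 2 ≤ m + 6 by omega), if_pos (show 4 ≤ m + 6 by omega),
      if_pos (show 6 ≤ m + 6 by omega), if_neg (show ¬ m + 6 = 1 by omega),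
      if_neg (show ¬ m + 6 = 3 by omega), if_neg (show ¬ m + 6 = 5 by omega),
      show m + 6 - 2 = m + 4 by omega,
      show m + 6 - 4 = m + 2 by omega, show m + 6 - 6 = m by omega]
    have o : ∀ t, Even t → (Odd (m + t) ↔ Odd m) := fun t ht => by
      simp [Nat.odd_add, ht]
    rw [if_congr (o 6 (by decide)) rfl rfl, if_congr (o 4 (by decide)) rfl rfl,
      if_congr (o 2 (by decide)) rfl rfl]
    split_ifs
    · push_cast; ring
    · ring

theorem phi_odd (x : Eˣ) (j : ℕ) :
    phi x (2 * (j : ℤ) + 1) = substPow (x : E) (2 * j) (oddGeom E) ∧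
      phi x (2 * (-((j : ℤ) + 1)) + 1) = -substPow (↑x⁻¹ : E) (2 * j) (oddGeom E) := by
  constructor
  · rw [show 2 * (j : ℤ) + 1 = Int.ofNat (2 * j + 1) by simp]; rfl
  · rw [show 2 * (-((j : ℤ) + 1)) + 1 = Int.negSucc (2 * j) by rw [Int.negSucc_eq]; push_cast; ring]
    rfl

theorem phi_even (x : Eˣ) (j : ℕ) :
    phi x (2 * ((j : ℤ) + 1)) = substPow (x : E) (2 * j + 1) (oddGeom E) ∧
      phi x (2 * (-((j : ℤ) + 1))) = -substPow (↑x⁻¹ : E) (2 * j + 1) (oddGeom E) := by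
  constructor
  · rw [show 2 * ((j : ℤ) + 1) = Int.ofNat (2 * j + 1 + 1) by simp; ring]; rfl
  · rw [show 2 * (-((j : ℤ) + 1)) = Int.negSucc (2 * j + 1) by
      rw [Int.negSucc_eq]; push_cast; ring]
    rfl

theorem coeff_zero_oddGeom : coeff 0 (oddGeom E) = 0 := by simp [oddGeom]

/-- `∑_{k, l odd} (x^k - x^{-k}) q^{kl}`. -/
noncomputable def sinhSeries (x : Eˣ) : E⟦X⟧ :=
  lambert fun k l => if Odd l ∧ Odd k then (x : E) ^ k - (↑x⁻¹ : E) ^ k else 0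

/-- `∑_{k, l odd} k² (x^k - x^{-k}) q^{kl}`. -/
noncomputable def sinhSeries₂ (x : Eˣ) : E⟦X⟧ :=
  lambert fun k l => if Odd l ∧ Odd k then (k : E) ^ 2 * ((x : E) ^ k - (↑x⁻¹ : E) ^ k) else 0

/-- `∑_{k even, l odd} (k / 2) (x^k + x^{-k}) q^{kl}`. -/
noncomputable def coshSeries (x : Eˣ) : E⟦X⟧ :=
  lambert fun k l =>
    if Odd l ∧ Even k then ((k / 2 : ℕ) : E) * ((x : E) ^ k + (↑x⁻¹ : E) ^ k) else 0

variable [TopologicalSpace E]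

theorem hasSum_of_eq {ι α : Type*} [AddCommMonoid α] [TopologicalSpace α] {f : ι → α} {a b : α}
    (h : HasSum f a) (e : a = b) : HasSum f b := e ▸ h

/-- The substitution has exponent l = m + 1, hence the shift `l - 1`. Vanishing constant terms leave
finitely many m for each coefficient. -/
theorem hasSum_substPow (z : E) (g : ℕ → E⟦X⟧) (h0 : ∀ m, coeff 0 (g m) = 0) :
    HasSum (fun m => substPow z m (g m)) (lambert fun k l => z ^ k * coeff k (g (l - 1))) := by
  rw [WithPiTopology.hasSum_iff_hasSum_coeff]
  intro N
  have h1 : coeff N (lambert fun k l => z ^ k * coeff k (g (l - 1))) =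
      ∑ m ∈ Finset.range N, coeff N (substPow z m (g m)) := by
    rw [lambert, coeff_mk,
      Nat.sum_divisorsAntidiagonal' (f := fun k l => z ^ k * coeff k (g (l - 1))), Nat.divisors,
      Finset.sum_filter, Finset.sum_Ico_eq_sum_range]
    refine Finset.sum_congr rfl fun m _ => ?_
    rw [coeff_substPow, add_comm 1 m, Nat.add_sub_cancel]
  rw [h1]
  refine hasSum_sum_of_ne_finset_zero fun m hm => ?_
  rw [coeff_substPow]
  split_ifs with hd
  · obtain rfl := Nat.eq_zero_of_dvd_of_lt hd (by simp at hm; omega)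
    rw [Nat.zero_div, h0, mul_zero]
  · rfl

theorem hasSum_substPow_odd (z : E) (g : ℕ → E⟦X⟧) (h0 : ∀ m, coeff 0 (g m) = 0) :
    HasSum (fun j => substPow z (2 * j) (g (2 * j + 1)))
      (lambert fun k l => if Odd l then z ^ k * coeff k (g l) else 0) := by
  have h := hasSum_substPow z (fun m => if Even m then g (m + 1) else 0)
    (fun m => by split_ifs <;> simp [h0])
  have inj : Function.Injective fun j : ℕ => 2 * j := fun a b h => by simpa using h
  rw [← inj.hasSum_iff] at h
  · refine (hasSum_congr_fun fun j => ?_).mp (hasSum_of_eq h ?_)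
    · simp
    · ext N
      simp only [lambert, coeff_mk]
      refine Finset.sum_congr rfl fun p hp => ?_
      have h2 : p.2 ≠ 0 := by
        rintro h
        simp [Nat.mem_divisorsAntidiagonal, h] at hp
        omega
      obtain ⟨l, hl⟩ := Nat.exists_eq_succ_of_ne_zero h2
      rw [hl]
      rcases Nat.even_or_odd l with h | h
      · simp [h, h.add_one]
      · have h3 : ¬ Even l := by simpa using h
        have h4 : ¬ Odd (l + 1) := by simpa [Nat.odd_add_one] using h
        simp [h3, h4]
  · intro m hm
    have : ¬ Even m := by
      rintro ⟨j, rfl⟩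
      exact hm ⟨j, by simp; ring⟩
    simp [this]

theorem hasSum_substPow_even (z : E) (g : ℕ → E⟦X⟧) (h0 : ∀ m, coeff 0 (g m) = 0) :
    HasSum (fun j => substPow z (2 * j + 1) (g (2 * j + 2)))
      (lambert fun k l => if Even l then z ^ k * coeff k (g l) else 0) := by
  have h := hasSum_substPow z (fun m => if Odd m then g (m + 1) else 0)
    (fun m => by split_ifs <;> simp [h0])
  have inj : Function.Injective fun j : ℕ => 2 * j + 1 := fun a b h => by simpa using h
  rw [← inj.hasSum_iff] at h
  · refine (hasSum_congr_fun fun j => ?_).mp (hasSum_of_eq h ?_)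
    · simp
    · ext N
      simp only [lambert, coeff_mk]
      refine Finset.sum_congr rfl fun p hp => ?_
      have h2 : p.2 ≠ 0 := by
        rintro h
        simp [Nat.mem_divisorsAntidiagonal, h] at hp
        omega
      obtain ⟨l, hl⟩ := Nat.exists_eq_succ_of_ne_zero h2
      rw [hl]
      rcases Nat.even_or_odd l with h | h
      · have h3 : ¬ Odd l := by simpa using h
        have h4 : ¬ Even (l + 1) := by simpa [Nat.even_add_one] using h
        simp [h3, h4]
      · simp [h, h.add_one]
  · intro m hm
    have : ¬ Odd m := by
      rintro ⟨j, rfl⟩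
      exact hm ⟨j, rfl⟩
    simp [this]

variable [IsTopologicalRing E]

theorem hasSum_phi_odd (x : Eˣ) : HasSum (fun j : ℤ => phi x (2 * j + 1)) (sinhSeries x) := by
  have h1 := hasSum_substPow_odd (x : E) (fun _ => oddGeom E) fun _ => coeff_zero_oddGeom
  have h2 := hasSum_substPow_odd (↑x⁻¹ : E) (fun _ => -oddGeom E)
    fun _ => by rw [map_neg, coeff_zero_oddGeom, neg_zero]
  refine hasSum_of_eq (HasSum.of_nat_of_neg_add_one (f := fun j : ℤ => phi x (2 * j + 1))
    ((hasSum_congr_fun fun j => ?_).mp h1)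
    ((hasSum_congr_fun fun j => ?_).mp h2)) ?_
  · exact (phi_odd x j).1.symm
  · rw [map_neg]; exact (phi_odd x j).2.symm
  · rw [← lambert_add]
    refine lambert_congr fun k l => ?_
    by_cases hl : Odd l <;> by_cases hk : Odd k <;> simp [hl, hk, oddGeom, sub_eq_add_neg]

theorem hasSum_phi_odd_sq (x : Eˣ) :
    HasSum (fun j : ℤ => phi x (2 * j + 1) ^ 2) (coshSeries x) := by
  have hc : coeff 0 (oddGeom E ^ 2) = 0 := by simp [coeff_oddGeom_sq]
  have h1 := hasSum_substPow_odd (x : E) (fun _ => oddGeom E ^ 2) fun _ => hc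
  have h2 := hasSum_substPow_odd (↑x⁻¹ : E) (fun _ => oddGeom E ^ 2) fun _ => hc
  refine hasSum_of_eq (HasSum.of_nat_of_neg_add_one (f := fun j : ℤ => phi x (2 * j + 1) ^ 2)
    ((hasSum_congr_fun fun j => ?_).mp h1)
    ((hasSum_congr_fun fun j => ?_).mp h2)) ?_
  · rw [(phi_odd x j).1, map_pow]
  · rw [(phi_odd x j).2, map_pow, neg_sq]
  · rw [← lambert_add]
    refine lambert_congr fun k l => ?_
    by_cases hl : Odd l <;> by_cases hk : Even k <;> simp [hl, hk, coeff_oddGeom_sq]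
    ring

theorem hasSum_phi_odd_ode (x : Eˣ) :
    HasSum (fun j : ℤ => phi x (2 * j + 1) + 8 * phi x (2 * j + 1) ^ 3) (sinhSeries₂ x) := by
  set g : E⟦X⟧ := mk fun k => if Odd k then (k : E) ^ 2 else 0 with hg
  have hc : coeff 0 g = 0 := by simp [hg]
  have h1 := hasSum_substPow_odd (x : E) (fun _ => g) fun _ => hc
  have h2 := hasSum_substPow_odd (↑x⁻¹ : E) (fun _ => -g)
    fun _ => by rw [map_neg, hc, neg_zero]
  refine hasSum_of_eq (HasSum.of_nat_of_neg_add_one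
    (f := fun j : ℤ => phi x (2 * j + 1) + 8 * phi x (2 * j + 1) ^ 3)
    ((hasSum_congr_fun fun j => ?_).mp h1)
    ((hasSum_congr_fun fun j => ?_).mp h2)) ?_
  · rw [(phi_odd x j).1, hg, oddGeom_ode, map_add, map_mul, map_pow, map_ofNat]
  · rw [(phi_odd x j).2, hg, oddGeom_ode, map_neg, map_add, map_mul, map_pow, map_ofNat]
    ring
  · rw [← lambert_add]
    refine lambert_congr fun k l => ?_
    by_cases hl : Odd l <;> by_cases hk : Odd k <;> simp [hl, hk, hg]
    ring

theorem hasSum_phi_even (x : Eˣ) : HasSum (fun j : ℤ => phi x (2 * j))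
    (C ((x : E) * Ring.inverse (1 - (x : E) ^ 2)) +
      lambert fun k l => if Even l ∧ Odd k then (x : E) ^ k - (↑x⁻¹ : E) ^ k else 0) := by
  have h1 := hasSum_substPow_even (x : E) (fun _ => oddGeom E) fun _ => coeff_zero_oddGeom
  have h2 := hasSum_substPow_even (↑x⁻¹ : E) (fun _ => -oddGeom E)
    fun _ => by rw [map_neg, coeff_zero_oddGeom, neg_zero]
  refine hasSum_of_eq (HasSum.of_add_one_of_neg_add_one (f := fun j : ℤ => phi x (2 * j))
    ((hasSum_congr_fun fun j => ?_).mp h1)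
    ((hasSum_congr_fun fun j => ?_).mp h2)) ?_
  · exact (phi_even x j).1.symm
  · rw [map_neg]; exact (phi_even x j).2.symm
  · have e : lambert (fun k l => if Even l ∧ Odd k then (x : E) ^ k - (↑x⁻¹ : E) ^ k else 0) =
        lambert (fun k l => if Even l then (x : E) ^ k * coeff k (oddGeom E) else 0) +
        lambert (fun k l => if Even l then (↑x⁻¹ : E) ^ k * coeff k (-oddGeom E) else 0) := by
      rw [← lambert_add]
      refine lambert_congr fun k l => ?_
      by_cases hl : Even l <;> by_cases hk : Odd k <;> simp [hl, hk, oddGeom, sub_eq_add_neg]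
    rw [e, mul_zero, show phi x 0 = C ((x : E) * Ring.inverse (1 - (x : E) ^ 2)) from rfl]
    ring

theorem hasSum_mul_phi_one_even : HasSum (fun e : ℤ => ((2 * e : ℤ) : E⟦X⟧) * phi 1 (2 * e))
    (lambert fun k l => if Even l ∧ Odd k then 2 * (l : E) else 0) := by
  have h1 := hasSum_substPow_even (1 : E) (fun l => (l : E⟦X⟧) * oddGeom E) fun _ => by
    rw [← map_natCast (C (R := E)), coeff_C_mul, coeff_zero_oddGeom, mul_zero]
  refine hasSum_of_eq (HasSum.of_add_one_of_neg_add_one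
    (f := fun e : ℤ => ((2 * e : ℤ) : E⟦X⟧) * phi 1 (2 * e))
    ((hasSum_congr_fun fun j => ?_).mp h1)
    ((hasSum_congr_fun fun j => ?_).mp h1)) ?_
  · rw [(phi_even 1 j).1, map_mul, map_natCast]
    push_cast; ring
  · rw [(phi_even 1 j).2, map_mul, map_natCast]
    push_cast; simp; ring
  · rw [mul_zero, Int.cast_zero, zero_mul, add_zero, ← lambert_add]
    refine lambert_congr fun k l => ?_
    rw [← map_natCast (C (R := E)), coeff_C_mul]
    by_cases hl : Even l <;> by_cases hk : Odd k <;> simp [hl, hk, oddGeom]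
    ring

theorem hasSum_mul_phi_one_odd :
    HasSum (fun e : ℤ => ((2 * e + 1 : ℤ) : E⟦X⟧) * phi 1 (2 * e + 1))
      (lambert fun k l => if Odd l ∧ Odd k then 2 * (l : E) else 0) := by
  have h1 := hasSum_substPow_odd (1 : E) (fun l => (l : E⟦X⟧) * oddGeom E) fun _ => by
    rw [← map_natCast (C (R := E)), coeff_C_mul, coeff_zero_oddGeom, mul_zero]
  refine hasSum_of_eq (HasSum.of_nat_of_neg_add_one
    (f := fun e : ℤ => ((2 * e + 1 : ℤ) : E⟦X⟧) * phi 1 (2 * e + 1))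
    ((hasSum_congr_fun fun j => ?_).mp h1)
    ((hasSum_congr_fun fun j => ?_).mp h1)) ?_
  · rw [(phi_odd 1 j).1, map_mul, map_natCast]
    push_cast; ring
  · rw [(phi_odd 1 j).2, map_mul, map_natCast]
    push_cast; simp; ring
  · rw [← lambert_add]
    refine lambert_congr fun k l => ?_
    rw [← map_natCast (C (R := E)), coeff_C_mul]
    by_cases hl : Odd l <;> by_cases hk : Odd k <;> simp [hl, hk, oddGeom]
    ring

end Lambert

/-! ### Quadratic identities and the differential equation. -/

section EllipticIdentities

open PowerSeries
open scoped PowerSeries.WithPiTopology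

variable {E : Type*} [CommRing E]

theorem mem_range_map_iff (f : E⟦X⟧) :
    f ∈ (PowerSeries.map (Int.castRingHom E)).range ↔
      ∀ n, coeff n f ∈ (Int.castRingHom E).range := by
  constructor
  · rintro ⟨g, rfl⟩ n
    exact ⟨coeff n g, by simp⟩
  · intro h
    choose g hg using h
    exact ⟨mk g, by ext n; simpa using hg n⟩

/-- Used to see that b has integer coefficients and is therefore killed by d/du; its value is never
needed. -/
theorem hasSum_mem_range {ι : Type*} [TopologicalSpace E] [DiscreteTopology E] {f : ι → E⟦X⟧}
    {a : E⟦X⟧} (h : HasSum f a) (hf : ∀ i, f i ∈ (PowerSeries.map (Int.castRingHom E)).range) :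
    a ∈ (PowerSeries.map (Int.castRingHom E)).range := by
  rw [mem_range_map_iff]
  intro n
  have hn := (WithPiTopology.hasSum_iff_hasSum_coeff (R := E)).mp h n
  exact (isClosed_discrete ((Int.castRingHom E).range : Set E)).mem_of_tendsto hn
    (Filter.Eventually.of_forall fun s => sum_mem fun i _ => (mem_range_map_iff _).mp (hf i) n)

theorem substPow_one_mem (m : ℕ) (g : E⟦X⟧)
    (hg : g ∈ (PowerSeries.map (Int.castRingHom E)).range) :
    substPow 1 m g ∈ (PowerSeries.map (Int.castRingHom E)).range := by
  rw [mem_range_map_iff] at hg ⊢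
  intro n
  rw [coeff_substPow]
  split_ifs
  · rw [one_pow, one_mul]; exact hg _
  · exact zero_mem _

theorem oddGeom_mem : oddGeom E ∈ (PowerSeries.map (Int.castRingHom E)).range := by
  rw [mem_range_map_iff]
  intro n
  rw [oddGeom, coeff_mk]
  split_ifs
  · exact one_mem _
  · exact zero_mem _

theorem X_mem : (X : E⟦X⟧) ∈ (PowerSeries.map (Int.castRingHom E)).range := ⟨X, by simp⟩

theorem phi_one_mem (n : ℤ) : phi (1 : Eˣ) n ∈ (PowerSeries.map (Int.castRingHom E)).range := by
  rcases n with (_ | m) | m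
  · change phi (1 : Eˣ) 0 ∈ _
    rw [phi_one_zero]; exact zero_mem _
  · exact substPow_one_mem m _ oddGeom_mem
  · rw [phi, inv_one]; exact neg_mem (substPow_one_mem m _ oddGeom_mem)

theorem cot_one_mem (n : ℤ) : cot (1 : Eˣ) n ∈ (PowerSeries.map (Int.castRingHom E)).range := by
  refine add_mem (intCast_mem _ _) ?_
  have h : ∀ m, 2 * substPow 1 m (X * oddGeom E) ∈ (PowerSeries.map (Int.castRingHom E)).range :=
    fun m => mul_mem (ofNat_mem _ 2) (substPow_one_mem m _ (mul_mem X_mem oddGeom_mem))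
  rcases n with (_ | m) | m
  · have : rho (1 : Eˣ) (Int.ofNat 0) = 0 := by simp [rho]
    exact this ▸ zero_mem _
  · exact h m
  · rw [rho, inv_one]; exact neg_mem (h m)

variable [IsDomain E] [CharZero E]

/-- The square of `sinhSeries` up to a constant term. -/
theorem sinhSeries_sq (x : Eˣ) : 2 * sinhSeries x ^ 2 =
    2 * coshSeries x - lambert fun k l => if Even l ∧ Odd k then 2 * (l : E) else 0 := by
  let _ : TopologicalSpace E := ⊥
  have _ : DiscreteTopology E := ⟨rfl⟩
  rw [sq]
  refine two_mul_phiSum_mul_phiSum x 0 (Or.inl rfl) (hasSum_phi_odd x) ?_ ?_ ?_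
  · simpa using hasSum_phi_odd x
  · simpa using hasSum_phi_odd_sq x
  · simpa using hasSum_mul_phi_one_even (E := E)

/-- Odd and even translates never coincide, so there is no diagonal term and W = 0. -/
theorem sinhSeries_mul_even (x : Eˣ) (hx : IsUnit (1 - (x : E) ^ 2)) :
    2 * (sinhSeries x * (C ((x : E) * Ring.inverse (1 - (x : E) ^ 2)) +
      lambert fun k l => if Even l ∧ Odd k then (x : E) ^ k - (↑x⁻¹ : E) ^ k else 0)) =
    -lambert fun k l => if Odd l ∧ Odd k then 2 * (l : E) else 0 := by
  let _ : TopologicalSpace E := ⊥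
  have _ : DiscreteTopology E := ⟨rfl⟩
  have h := two_mul_phiSum_mul_phiSum x 1 (Or.inr ⟨rfl, hx⟩) (hasSum_phi_odd x) (W := 0)
    (S' := C ((x : E) * Ring.inverse (1 - (x : E) ^ 2)) +
      lambert fun k l => if Even l ∧ Odd k then (x : E) ^ k - (↑x⁻¹ : E) ^ k else 0) ?_ ?_
    (hasSum_mul_phi_one_odd (E := E))
  · rw [h]; simp
  · refine (hasSum_congr_fun fun j => ?_).mp ((Equiv.addRight (1 : ℤ)).hasSum_iff.mpr
      (hasSum_phi_even x))
    simp only [Function.comp, Equiv.coe_addRight]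
    congr 1
    ring
  · simp

/-- The differential equation of the elliptic function `sinhSeries`. -/
theorem sinhSeries_ode (x : Eˣ) :
    ∃ b ∈ (PowerSeries.map (Int.castRingHom E)).range,
      sinhSeries₂ x = b * sinhSeries x + 8 * sinhSeries x ^ 3 := by
  let _ : TopologicalSpace E := ⊥
  have _ : DiscreteTopology E := ⟨rfl⟩
  have inj1 : Function.Injective fun j : ℤ => 2 * j + 1 := fun a b h => by
    simp only at h; omega
  have inj2 : Function.Injective fun j : ℤ => 2 * j := fun a b h => by
    simp only at h; omega
  obtain ⟨e, he⟩ : Summable fun e : ℤ =>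
      2 * phi (1 : Eˣ) (2 * e) ^ 2 - phi 1 (2 * e) * cot 1 (2 * e) := by
    have h := (isSmall_phi (1 : Eˣ) inj2).mul_right
      fun e => 2 * phi 1 (2 * e) - cot 1 (2 * e)
    refine h.summable.congr fun e => ?_
    ring
  obtain ⟨T, hT⟩ : Summable fun j : ℤ => phi x (2 * j + 1) ^ 3 := by
    have h := (isSmall_phi x inj1).mul_right fun j => phi x (2 * j + 1) ^ 2
    refine h.summable.congr fun e => ?_
    ring
  have hk := hasSum_mul_phi_one_even (E := E)
  set k : E⟦X⟧ := lambert fun k l => if Even l ∧ Odd k then 2 * (l : E) else 0 with hkdef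
  have h1 : 2 * sinhSeries x ^ 2 = 2 * coshSeries x - k := sinhSeries_sq x
  have h2 := two_mul_phiSqSum_mul_phiSum x (hasSum_phi_odd x) (hasSum_phi_odd_sq x) hT he
  have h3 : sinhSeries₂ x = sinhSeries x + 8 * T :=
    (hasSum_phi_odd_ode x).unique ((hasSum_phi_odd x).add (hT.mul_left 8))
  have he' := hasSum_mem_range he fun i => sub_mem
    (mul_mem (ofNat_mem _ 2) (pow_mem (phi_one_mem _) 2)) (mul_mem (phi_one_mem _) (cot_one_mem _))
  have hk' := hasSum_mem_range hk fun i => mul_mem (intCast_mem _ _) (phi_one_mem _)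
  -- Eliminate W and T from S'' = S + 8T, 2WS = 2T + eS and 2S² = 2W - k.
  refine ⟨1 - 4 * (e - k), sub_mem (one_mem _) (mul_mem (ofNat_mem _ 4) (sub_mem he' hk')), ?_⟩
  linear_combination h3 - 4 * h2 - 4 * sinhSeries x * h1

end EllipticIdentities

/-! ### Taylor coefficients at u = 0 for x = e^u; the inner variable is u, the outer one q. -/

section HankelLambert

open PowerSeries

theorem coeff_zero_lambert {E : Type*} [CommRing E] (w : ℕ → ℕ → E) :
    coeff 0 (lambert w) = 0 := by simp [lambert]

theorem map_lambert {E F : Type*} [CommRing E] [CommRing F] (f : E →+* F) (w : ℕ → ℕ → E) :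
    PowerSeries.map f (lambert w) = lambert fun k l => f (w k l) := by
  ext N; simp [lambert]

theorem C_mul_lambert {E : Type*} [CommRing E] (a : E) (w : ℕ → ℕ → E) :
    C a * lambert w = lambert fun k l => a * w k l := by
  ext N; simp [lambert, Finset.mul_sum]

theorem lambert_swap {E : Type*} [CommRing E] (w : ℕ → ℕ → E) :
    lambert (fun k l => w l k) = lambert w := by
  ext N
  simp only [lambert, coeff_mk]
  rw [← Nat.map_swap_divisorsAntidiagonal, Finset.sum_map]
  simp

theorem expand_lambert {E : Type*} [CommRing E] (w : ℕ → ℕ → E) :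
    expand 2 two_ne_zero (lambert w) = lambert fun k l => if Even k then w (k / 2) l else 0 := by
  ext N
  rw [coeff_expand]
  simp only [lambert, coeff_mk]
  split_ifs with h
  · obtain ⟨M, rfl⟩ := h
    rw [← Finset.sum_filter]
    refine Finset.sum_bij' (fun p _ => (2 * p.1, p.2)) (fun p _ => (p.1 / 2, p.2)) ?_ ?_ ?_ ?_ ?_
    · rintro ⟨k, l⟩ h
      simp only [Nat.mem_divisorsAntidiagonal, Finset.mem_filter] at h ⊢
      refine ⟨⟨?_, by omega⟩, by simp⟩
      have : k * l = M := by omega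
      rw [← this]; ring
    · rintro ⟨k, l⟩ h
      simp only [Nat.mem_divisorsAntidiagonal, Finset.mem_filter] at h ⊢
      obtain ⟨⟨h1, h2⟩, j, rfl⟩ := h
      refine ⟨?_, by omega⟩
      have h3 : 2 * (j * l) = 2 * M := by rw [← h1]; ring
      have h4 : (j + j) / 2 = j := by omega
      rw [h4]; omega
    · rintro ⟨k, l⟩ h; simp
    · rintro ⟨k, l⟩ h
      simp only [Finset.mem_filter] at h
      obtain ⟨-, j, rfl⟩ := h
      simp; omega
    · rintro ⟨k, l⟩ h; simp
  · symm
    refine Finset.sum_eq_zero fun p hp => if_neg fun hk => h ?_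
    rw [Nat.mem_divisorsAntidiagonal] at hp
    rw [← hp.1]
    exact Dvd.dvd.mul_right hk.two_dvd _

/-- The derivation on power series over `K⟦X⟧` that acts on coefficients. -/
noncomputable def coeffDerivation (K : Type*) [CommRing K] :
    Derivation K (K⟦X⟧)⟦X⟧ (K⟦X⟧)⟦X⟧ :=
  Derivation.mk'
    { toFun := fun f => mk fun n => derivative K (coeff n f)
      map_add' := fun f g => by ext1 n; simp
      map_smul' := fun c f => by ext1 n; simp }
    fun f g => by
      ext1 n
      simp only [LinearMap.coe_mk, AddHom.coe_mk, smul_eq_mul,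
        coeff_mk, map_add, coeff_mul, map_sum, Derivation.leibniz]
      rw [Finset.sum_add_distrib]
      congr 1
      rw [← Finset.Nat.sum_antidiagonal_swap]
      rfl

theorem coeff_coeffDerivation {K : Type*} [CommRing K] (f : (K⟦X⟧)⟦X⟧) (n : ℕ) :
    coeff n (coeffDerivation K f) = derivative K (coeff n f) := by
  simp [coeffDerivation]

theorem coeffDerivation_lambert {K : Type*} [CommRing K] (w : ℕ → ℕ → K⟦X⟧) :
    coeffDerivation K (lambert w) = lambert fun k l => derivative K (w k l) := by
  ext1 n
  rw [coeff_coeffDerivation]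
  simp [lambert]

theorem iterate_coeffDerivation_lambert {K : Type*} [CommRing K] (w : ℕ → ℕ → K⟦X⟧) (r : ℕ) :
    (coeffDerivation K)^[r] (lambert w) = lambert fun k l => (derivative K)^[r] (w k l) := by
  induction r with
  | zero => rfl
  | succ r ih =>
    rw [Function.iterate_succ_apply', ih, coeffDerivation_lambert]
    simp only [Function.iterate_succ_apply']

theorem coeffDerivation_eq_zero {K : Type*} [CommRing K] {b : (K⟦X⟧)⟦X⟧}
    (hb : b ∈ (PowerSeries.map (Int.castRingHom K⟦X⟧)).range) : coeffDerivation K b = 0 := by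
  obtain ⟨c, rfl⟩ := hb
  ext1 n
  rw [coeff_coeffDerivation]
  simp

/-- The exponential series as a unit. -/
noncomputable def expUnit : ℂ⟦X⟧ˣ where
  val := exp ℂ
  inv := evalNegHom (exp ℂ)
  val_inv := exp_mul_exp_neg_eq_one
  inv_val := by rw [mul_comm]; exact exp_mul_exp_neg_eq_one

theorem derivative_expUnit : derivative ℂ (expUnit : ℂ⟦X⟧) = expUnit := derivative_exp ℂ

theorem derivative_expUnit_inv : derivative ℂ (↑expUnit⁻¹ : ℂ⟦X⟧) = -↑expUnit⁻¹ := by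
  rw [Derivation.leibniz_of_mul_eq_one _ expUnit.inv_mul, derivative_expUnit, smul_eq_mul, sq,
    neg_mul, mul_assoc, expUnit.inv_mul, mul_one]

theorem iterate_derivative_sub_add (k r : ℕ) (a : ℂ) :
    (derivative ℂ)^[r] ((expUnit : ℂ⟦X⟧) ^ k + C a * (↑expUnit⁻¹ : ℂ⟦X⟧) ^ k) =
      C ((k : ℂ) ^ r) * (expUnit : ℂ⟦X⟧) ^ k + C (a * (-k) ^ r) * (↑expUnit⁻¹ : ℂ⟦X⟧) ^ k := by
  have h1 : derivative ℂ ((expUnit : ℂ⟦X⟧) ^ k) = C (k : ℂ) * (expUnit : ℂ⟦X⟧) ^ k := by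
    rw [Derivation.leibniz_pow, derivative_expUnit]
    rcases k with _ | k
    · simp
    · simp [pow_succ]
  have h2 : derivative ℂ ((↑expUnit⁻¹ : ℂ⟦X⟧) ^ k) = C (-k : ℂ) * (↑expUnit⁻¹ : ℂ⟦X⟧) ^ k := by
    rw [Derivation.leibniz_pow, derivative_expUnit_inv]
    rcases k with _ | k
    · simp
    · simp [pow_succ]; ring
  induction r with
  | zero => simp
  | succ r ih =>
    rw [Function.iterate_succ_apply', ih, map_add, Derivation.leibniz, Derivation.leibniz, h1, h2,
      derivative_C, derivative_C]
    simp only [smul_eq_mul, pow_succ, map_mul]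
    ring

theorem constantCoeff_expUnit : constantCoeff (expUnit : ℂ⟦X⟧) = 1 := constantCoeff_exp

theorem constantCoeff_expUnit_inv : constantCoeff (↑expUnit⁻¹ : ℂ⟦X⟧) = 1 := by
  have h := congrArg constantCoeff expUnit.mul_inv
  rwa [map_mul, constantCoeff_expUnit, one_mul, map_one] at h

/-- `∑_{k, l odd} k^{2r+1} q^{kl}`. -/
noncomputable def oddMoment (r : ℕ) : ℂ⟦X⟧ :=
  lambert fun k l => if Odd l ∧ Odd k then (k : ℂ) ^ (2 * r + 1) else 0

/-- `∑_{l odd} k^{2r+1} q^{kl}`. -/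
noncomputable def moment (r : ℕ) : ℂ⟦X⟧ :=
  lambert fun k l => if Odd l then (k : ℂ) ^ (2 * r + 1) else 0

theorem coeffDerivation_sq_sinhSeries :
    coeffDerivation ℂ (coeffDerivation ℂ (sinhSeries expUnit)) = sinhSeries₂ expUnit := by
  have h := iterate_coeffDerivation_lambert (K := ℂ) (fun k l => if Odd l ∧ Odd k then
    (expUnit : ℂ⟦X⟧) ^ k - (↑expUnit⁻¹ : ℂ⟦X⟧) ^ k else 0) 2
  refine h.trans (lambert_congr fun k l => ?_)
  split_ifs
  · have := iterate_derivative_sub_add k 2 (-1)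
    rw [map_neg, map_one, neg_one_mul, ← sub_eq_add_neg] at this
    rw [this]
    simp
    ring
  · simp

theorem ev_iterate_sinhSeries (r : ℕ) :
    PowerSeries.map constantCoeff ((coeffDerivation ℂ)^[2 * r + 1] (sinhSeries expUnit)) =
      2 * oddMoment r := by
  rw [sinhSeries, iterate_coeffDerivation_lambert, map_lambert, oddMoment,
    ← map_ofNat (C (R := ℂ)) 2, C_mul_lambert]
  refine lambert_congr fun k l => ?_
  split_ifs
  · have := iterate_derivative_sub_add k (2 * r + 1) (-1)
    rw [map_neg, map_one, neg_one_mul, ← sub_eq_add_neg] at this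
    rw [this]
    simp only [map_add, map_mul, map_pow, constantCoeff_expUnit, constantCoeff_expUnit_inv,
      constantCoeff_C, one_pow, mul_one]
    rw [Odd.neg_pow ⟨r, rfl⟩]
    ring
  · rw [iterate_map_zero]; simp

/-- For k = 2j the term is 2 · j · (2j)^{2r+2} = 2^{2r+3} j^{2r+3}, with exponent 2jl; hence the
expansion q ↦ q². -/
theorem ev_iterate_coshSeries (r : ℕ) :
    PowerSeries.map constantCoeff ((coeffDerivation ℂ)^[2 * r + 2] (coshSeries expUnit)) =
      2 ^ (2 * r + 3) * expand 2 two_ne_zero (moment (r + 1)) := by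
  rw [coshSeries, iterate_coeffDerivation_lambert, map_lambert, moment, expand_lambert,
    ← map_ofNat (C (R := ℂ)) 2, ← map_pow, C_mul_lambert]
  refine lambert_congr fun k l => ?_
  by_cases hl : Odd l <;> by_cases hk : Even k <;> simp only [hl, hk, and_self, and_true, and_false,
    if_true, if_false]
  · have h := iterate_derivative_sub_add k (2 * r + 2) 1
    rw [map_one, one_mul, one_mul] at h
    rw [show (((k / 2 : ℕ)) : ℂ⟦X⟧) * ((expUnit : ℂ⟦X⟧) ^ k + (↑expUnit⁻¹ : ℂ⟦X⟧) ^ k) =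
      (k / 2 : ℕ) • ((expUnit : ℂ⟦X⟧) ^ k + (↑expUnit⁻¹ : ℂ⟦X⟧) ^ k) by rw [nsmul_eq_mul],
      iterate_map_nsmul, h]
    obtain ⟨j, rfl⟩ := hk
    rw [show (j + j) / 2 = j by omega]
    simp only [map_nsmul, map_add, map_mul, map_pow, constantCoeff_expUnit,
      constantCoeff_expUnit_inv, constantCoeff_C, one_pow, mul_one]
    rw [Even.neg_pow ⟨r + 1, by ring⟩]
    simp only [nsmul_eq_mul]
    push_cast
    have h2 : ((j : ℂ) + j) ^ (2 * r + 2) = 2 ^ (2 * r + 2) * (j : ℂ) ^ (2 * r + 2) := by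
      rw [← two_mul, mul_pow]
    rw [h2]
    change _ = (2 : ℂ) ^ (2 * r + 3) * _
    ring
  all_goals rw [iterate_map_zero]; simp

/-- By `sinhSeries_sq`, S² differs from `coshSeries` by a series independent of u. -/
theorem ev_iterate_sinhSeries_sq (r : ℕ) :
    PowerSeries.map constantCoeff ((coeffDerivation ℂ)^[2 * r + 2] (sinhSeries expUnit ^ 2)) =
      2 ^ (2 * r + 3) * expand 2 two_ne_zero (moment (r + 1)) := by
  have h := sinhSeries_sq expUnit
  set κ : (ℂ⟦X⟧)⟦X⟧ := lambert fun k l => if Even l ∧ Odd k then 2 * (l : ℂ⟦X⟧) else 0 with hκ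
  have hκ0 : coeffDerivation ℂ κ = 0 := by
    rw [hκ, coeffDerivation_lambert]
    ext1 n
    rw [lambert, coeff_mk, map_zero]
    refine Finset.sum_eq_zero fun p _ => ?_
    split_ifs
    · rw [← Nat.cast_ofNat, ← Nat.cast_mul]; exact Derivation.map_natCast _ _
    · simp
  have h2 : coeffDerivation ℂ (sinhSeries expUnit ^ 2) = coeffDerivation ℂ (coshSeries expUnit) := by
    have h3 := congrArg (coeffDerivation ℂ) h
    have e : ∀ z : (ℂ⟦X⟧)⟦X⟧, 2 * z = (2 : ℕ) • z := fun z => by rw [nsmul_eq_mul]; rfl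
    rw [map_sub, hκ0, sub_zero, e, e, map_nsmul, map_nsmul] at h3
    exact smul_right_injective _ two_ne_zero h3
  rw [Function.iterate_succ_apply, h2, ← Function.iterate_succ_apply, ev_iterate_coshSeries]

theorem ev_sinhSeries : PowerSeries.map constantCoeff (sinhSeries expUnit) = 0 := by
  rw [sinhSeries, map_lambert]
  ext n
  simp only [lambert, coeff_mk, map_zero]
  refine Finset.sum_eq_zero fun p _ => ?_
  split_ifs
  · simp [constantCoeff_expUnit]
  · simp

theorem det_oddMoment (m : ℕ) :
    (Matrix.of fun i j : Fin m => oddMoment (i + j)).det =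
      ∏ n ∈ Finset.range m, (oddMoment 0 ^ (2 * n + 1) * 16 ^ n * (2 * n)! * (2 * n + 1)!) := by
  obtain ⟨b, hb, hode⟩ := sinhSeries_ode expUnit
  have h := det_hankel_odd_of_ode (coeffDerivation ℂ) (PowerSeries.map constantCoeff)
    (coeffDerivation_eq_zero hb) (coeffDerivation_sq_sinhSeries.trans hode) ev_sinhSeries m
  have h1 := ev_iterate_sinhSeries 0
  rw [mul_zero, zero_add, Function.iterate_one] at h1
  simp only [ev_iterate_sinhSeries, h1] at h
  have e : (Matrix.of fun i j : Fin m => 2 * oddMoment (i + j)) =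
      (2 : ℂ⟦X⟧) • (Matrix.of fun i j : Fin m => oddMoment (i + j)) := by
    ext1 i j; simp
  rw [e, Matrix.det_smul, Fintype.card_fin] at h
  have h2 : (2 : ℂ⟦X⟧) ^ m ≠ 0 := pow_ne_zero _ two_ne_zero
  apply mul_left_cancel₀ h2
  rw [h, ← Finset.card_range m, ← Finset.prod_const, Finset.card_range, ← Finset.prod_mul_distrib]
  refine Finset.prod_congr rfl fun n _ => ?_
  rw [mul_pow, show (16 : ℂ⟦X⟧) = 4 * 4 by norm_num, mul_pow, pow_succ, pow_mul]
  norm_num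
  ring

/-- The entries carry 2^{2(i+j)+3}; rows and columns release 2^{4n+3} per index against 2^{4n+2} on
the other side, leaving the factor 2^m. -/
theorem det_moment (m : ℕ) :
    2 ^ m * expand 2 two_ne_zero (Matrix.of fun i j : Fin m => moment (i + j + 1)).det =
      ∏ n ∈ Finset.range m, (oddMoment 0 ^ (2 * n + 2) * (2 * n + 1)! * (2 * n + 2)!) := by
  obtain ⟨b, hb, hode⟩ := sinhSeries_ode expUnit
  have h := det_hankel_even_of_ode (coeffDerivation ℂ) (PowerSeries.map constantCoeff)
    (coeffDerivation_eq_zero hb) (coeffDerivation_sq_sinhSeries.trans hode) ev_sinhSeries m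
  have h1 := ev_iterate_sinhSeries 0
  rw [mul_zero, zero_add, Function.iterate_one] at h1
  simp only [ev_iterate_sinhSeries_sq, h1] at h
  have e : (Matrix.of fun i j : Fin m => 2 ^ (2 * ((i : ℕ) + j) + 3) *
      expand 2 two_ne_zero (moment (i + j + 1))) =
      Matrix.of fun i j : Fin m => (2 : ℂ⟦X⟧) ^ (2 * (i : ℕ) + 3) *
        (Matrix.of fun i j : Fin m => 2 ^ (2 * (j : ℕ)) *
          (Matrix.of fun i j : Fin m => expand 2 two_ne_zero (moment (i + j + 1))) i j) i j := by
    ext1 i j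
    simp only [Matrix.of_apply]
    ring
  rw [e, Matrix.det_mul_column, Matrix.det_mul_row] at h
  have e2 : (Matrix.of fun i j : Fin m => expand 2 two_ne_zero (moment (i + j + 1))).det =
      expand 2 two_ne_zero (Matrix.of fun i j : Fin m => moment (i + j + 1)).det := by
    rw [AlgHom.map_det]
    rfl
  rw [e2, ← Finset.prod_range fun n => (2 : ℂ⟦X⟧) ^ (2 * n + 3),
    ← Finset.prod_range fun n => (2 : ℂ⟦X⟧) ^ (2 * n), ← mul_assoc,
    ← Finset.prod_mul_distrib] at h
  have h2 : ∏ n ∈ Finset.range m, (2 : ℂ⟦X⟧) ^ (4 * n + 2) ≠ 0 :=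
    Finset.prod_ne_zero_iff.mpr fun n _ => pow_ne_zero _ two_ne_zero
  apply mul_left_cancel₀ h2
  have h3 : ∏ n ∈ Finset.range m, ((2 : ℂ⟦X⟧) ^ (2 * n + 3) * 2 ^ (2 * n)) =
      (∏ n ∈ Finset.range m, (2 : ℂ⟦X⟧) ^ (4 * n + 2)) * 2 ^ m := by
    rw [← Finset.card_range m, ← Finset.prod_const, Finset.card_range, ← Finset.prod_mul_distrib]
    exact Finset.prod_congr rfl fun n _ => by ring
  rw [← mul_assoc, ← h3, h, ← Finset.prod_mul_distrib]
  refine Finset.prod_congr rfl fun n _ => ?_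
  rw [mul_pow, show (4 : ℂ⟦X⟧) = 2 ^ 2 by norm_num, ← pow_mul, show 4 * n + 2 = 2 * n + 2 + 2 * n by ring, pow_add _ (2 * n + 2) (2 * n)]
  ring

end HankelLambert

/-! ### Theta series and arithmetic-geometric mean relations. -/

section Theta

open PowerSeries
open scoped PowerSeries.WithPiTopology

theorem X_pow_dvd_expand {E : Type*} [CommRing E] {p : ℕ} (hp : p ≠ 0) {n : ℕ} {f : E⟦X⟧}
    (h : X ^ n ∣ f) : X ^ (p * n) ∣ expand p hp f := by
  obtain ⟨g, rfl⟩ := h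
  exact ⟨expand p hp g, by rw [map_mul, map_pow, expand_X, pow_mul]⟩

theorem expand_injective {E : Type*} [CommRing E] {p : ℕ} (hp : p ≠ 0) :
    Function.Injective (expand p hp : E⟦X⟧ → E⟦X⟧) := fun f g h => by
  ext n
  rw [← coeff_expand_mul p hp f n, ← coeff_expand_mul p hp g n, h]

theorem X_dvd_sub_of_constantCoeff {E : Type*} [CommRing E] {f g : E⟦X⟧}
    (h : constantCoeff f = constantCoeff g) : X ∣ f - g := by
  rw [X_dvd_iff, map_sub, h, sub_self]

/-- A pair of power series satisfying the arithmetic-geometric mean relations is determined by its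
leading terms. -/
theorem agm_unique {u v u' v' : ℂ⟦X⟧}
    (h1 : v = expand 2 two_ne_zero (X ^ 2 * u) + expand 2 two_ne_zero v)
    (h2 : (X ^ 2 * u) ^ 2 = 4 * expand 2 two_ne_zero (X ^ 2 * u) * expand 2 two_ne_zero v)
    (h1' : v' = expand 2 two_ne_zero (X ^ 2 * u') + expand 2 two_ne_zero v')
    (h2' : (X ^ 2 * u') ^ 2 = 4 * expand 2 two_ne_zero (X ^ 2 * u') * expand 2 two_ne_zero v')
    (hu : constantCoeff u = 4) (hu' : constantCoeff u' = 4)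
    (hv : constantCoeff v = constantCoeff v') : u = u' := by
  -- The substitution q ↦ q² doubles the order of agreement. For u this survives division by X⁴ and
  -- by u + u', a unit with constant term 8.
  have step : ∀ n, X ^ (n + 1) ∣ u - u' → X ^ (n + 3) ∣ v - v' →
      X ^ (n + 2) ∣ u - u' ∧ X ^ (n + 4) ∣ v - v' := by
    intro n hn hn'
    have hx : X ^ (n + 3) ∣ X ^ 2 * u - X ^ 2 * u' := by
      rw [← mul_sub, show n + 3 = 2 + (n + 1) by ring, pow_add]
      exact mul_dvd_mul_left _ hn
    constructor
    · have h3 : X ^ (2 * (n + 3)) ∣ (X ^ 2 * u) ^ 2 - (X ^ 2 * u') ^ 2 := by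
        rw [h2, h2', mul_assoc, mul_assoc, ← mul_sub, ← map_mul, ← map_mul, ← map_sub]
        refine Dvd.dvd.mul_left (X_pow_dvd_expand two_ne_zero ?_) _
        have e : X ^ 2 * u * v - X ^ 2 * u' * v' =
            (X ^ 2 * u - X ^ 2 * u') * v + X ^ 2 * u' * (v - v') := by ring
        rw [e]
        exact dvd_add (Dvd.dvd.mul_right hx _) (Dvd.dvd.mul_left hn' _)
      have hunit : IsUnit (u + u') := by
        rw [isUnit_iff_constantCoeff, map_add, hu, hu']
        norm_num
      have e : (X ^ 2 * u) ^ 2 - (X ^ 2 * u') ^ 2 = X ^ 4 * ((u - u') * (u + u')) := by ring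
      rw [e, show 2 * (n + 3) = 4 + (2 * n + 2) by ring, pow_add X 4] at h3
      have h4 := (mul_dvd_mul_iff_left (pow_ne_zero 4 X_ne_zero)).mp h3
      rw [hunit.dvd_mul_right] at h4
      exact (pow_dvd_pow X (by omega)).trans h4
    · rw [h1, h1', add_sub_add_comm, ← map_sub, ← map_sub, ← map_add]
      exact (pow_dvd_pow X (by omega : n + 4 ≤ 2 * (n + 3))).trans
        (X_pow_dvd_expand two_ne_zero (dvd_add hx hn'))
  have base : X ^ 1 ∣ u - u' ∧ X ^ 3 ∣ v - v' := by
    have b1 : X ^ 1 ∣ u - u' := by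
      rw [pow_one]; exact X_dvd_sub_of_constantCoeff (hu.trans hu'.symm)
    have b2 : X ^ 2 ∣ X ^ 2 * u - X ^ 2 * u' := by rw [← mul_sub]; exact dvd_mul_right _ _
    have b3 : ∀ n ≤ 2, X ^ n ∣ v - v' → X ^ (2 * n) ∣ v - v' := by
      intro n hn hd
      rw [h1, h1', add_sub_add_comm, ← map_sub, ← map_sub, ← map_add]
      exact X_pow_dvd_expand two_ne_zero (dvd_add ((pow_dvd_pow X hn).trans b2) hd)
    have b4 := b3 2 le_rfl (b3 1 (by norm_num)
      (by rw [pow_one]; exact X_dvd_sub_of_constantCoeff hv))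
    exact ⟨b1, (pow_dvd_pow X (by norm_num)).trans b4⟩
  have all : ∀ n, X ^ (n + 1) ∣ u - u' ∧ X ^ (n + 3) ∣ v - v' := by
    intro n
    induction n with
    | zero => exact base
    | succ n ih => exact step n ih.1 ih.2
  rw [← sub_eq_zero]
  ext n
  exact X_pow_dvd_iff.mp (all n).1 n (by omega)

/-- The square term `q^{n²}` of the theta series, restricted to `n` with a given property. -/
noncomputable def thetaTerm (P : ℤ → Prop) [DecidablePred P] (n : ℤ) : ℂ⟦X⟧ :=
  if P n then X ^ (n.natAbs ^ 2) else 0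

theorem isSmall_thetaTerm (P : ℤ → Prop) [DecidablePred P] : IsSmall (thetaTerm P) := by
  intro N
  refine (Set.finite_Icc (-(N : ℤ)) N).subset fun n hn => ?_
  have h : N = n.natAbs ^ 2 := by
    by_contra h
    apply hn
    rw [thetaTerm]
    split_ifs
    · rw [coeff_X_pow, if_neg h]
    · simp
  have h2 : n.natAbs ≤ N := by rw [h]; exact Nat.le_self_pow two_ne_zero _
  rw [Set.mem_Icc]
  omega

theorem hasSum_expand {ι : Type*} {p : ℕ} (hp : p ≠ 0) {f : ι → ℂ⟦X⟧} {a : ℂ⟦X⟧}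
    (h : HasSum f a) : HasSum (fun i => expand p hp (f i)) (expand p hp a) := by
  rw [WithPiTopology.hasSum_iff_hasSum_coeff] at h ⊢
  intro n
  simp only [coeff_expand]
  split_ifs
  · exact h _
  · exact hasSum_zero

theorem injective_add_sub : Function.Injective fun q : ℤ × ℤ => (q.1 + q.2, q.1 - q.2) := by
  rintro ⟨a, b⟩ ⟨c, d⟩ h
  simp only [Prod.mk.injEq] at h ⊢
  omega

theorem X_pow_add_sub (s t : ℤ) : (X : ℂ⟦X⟧) ^ ((s + t).natAbs ^ 2) * X ^ ((s - t).natAbs ^ 2) =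
    expand 2 two_ne_zero (X ^ (s.natAbs ^ 2)) * expand 2 two_ne_zero (X ^ (t.natAbs ^ 2)) := by
  rw [map_pow, map_pow, expand_X, ← pow_mul, ← pow_mul, ← pow_add, ← pow_add]
  congr 1
  zify
  simp only [sq_abs]
  ring

/-- Pairs (a, b) of equal parity are exactly (s+t, s-t), with a² + b² = 2(s² + t²); a is odd exactly
when s and t have opposite parity. -/
theorem theta_odd_sq {o e : ℂ⟦X⟧} (ho : HasSum (thetaTerm Odd) o) (he : HasSum (thetaTerm Even) e) :
    o ^ 2 = 2 * expand 2 two_ne_zero o * expand 2 two_ne_zero e ∧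
      e ^ 2 = expand 2 two_ne_zero e ^ 2 + expand 2 two_ne_zero o ^ 2 := by
  have small2 : ∀ (P : ℤ → Prop) [DecidablePred P],
      IsSmall fun n => expand 2 two_ne_zero (thetaTerm P n) := by
    intro P _ N
    refine (isSmall_thetaTerm P (N / 2)).subset fun n hn => ?_
    simp only [Set.mem_ofPred_eq, coeff_expand] at hn ⊢
    exact fun h => hn (by simp [h])
  have ho2 := hasSum_expand two_ne_zero ho
  have he2 := hasSum_expand two_ne_zero he
  have hoo := ho.mul ho ((isSmall_thetaTerm Odd).mul_prod (isSmall_thetaTerm Odd)).summable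
  have hee := he.mul he ((isSmall_thetaTerm Even).mul_prod (isSmall_thetaTerm Even)).summable
  have h1 := ho2.mul he2 ((small2 Odd).mul_prod (small2 Even)).summable
  have h2 := he2.mul ho2 ((small2 Even).mul_prod (small2 Odd)).summable
  have h3 := ho2.mul ho2 ((small2 Odd).mul_prod (small2 Odd)).summable
  have h4 := he2.mul he2 ((small2 Even).mul_prod (small2 Even)).summable
  have range : ∀ a b : ℤ, (a, b) ∉ Set.range (fun q : ℤ × ℤ => (q.1 + q.2, q.1 - q.2)) →
      ¬ (Even a ↔ Even b) := by
    intro a b h hab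
    have : Even (a + b) := Int.even_add.mpr hab
    obtain ⟨s, hs⟩ := this
    exact h ⟨(s, a - s), by simp only [Prod.mk.injEq]; omega⟩
  constructor
  · rw [← injective_add_sub.hasSum_iff] at hoo
    · rw [sq]
      refine (hoo.unique ((hasSum_congr_fun fun q => ?_).mp (h1.add h2))).trans (by ring)
      obtain ⟨s, t⟩ := q
      simp only [Function.comp, thetaTerm, ← Int.not_even_iff_odd]
      simp only [Int.even_add, Int.even_sub]
      by_cases hs : Even s <;> by_cases ht : Even t <;> simp [hs, ht, X_pow_add_sub]
    · rintro ⟨a, b⟩ h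
      have := range a b h
      simp only [thetaTerm, ← Int.not_even_iff_odd]
      by_cases ha : Even a <;> by_cases hb : Even b <;> simp [ha, hb] at this ⊢
  · rw [← injective_add_sub.hasSum_iff] at hee
    · rw [sq]
      refine (hee.unique ((hasSum_congr_fun fun q => ?_).mp (h4.add h3))).trans (by ring)
      obtain ⟨s, t⟩ := q
      simp only [Function.comp, thetaTerm, Int.even_add, Int.even_sub, ← Int.not_even_iff_odd]
      by_cases hs : Even s <;> by_cases ht : Even t <;> simp [hs, ht, X_pow_add_sub]
    · rintro ⟨a, b⟩ h
      have := range a b h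
      simp only [thetaTerm]
      by_cases ha : Even a <;> by_cases hb : Even b <;> simp [ha, hb] at this ⊢

/-- The series of triangular numbers with complex coefficients. -/
noncomputable def triangleSeriesC : ℂ⟦X⟧ := PowerSeries.map (Nat.castRingHom ℂ) triangleSeries

theorem constantCoeff_triangleSeriesC : constantCoeff triangleSeriesC = 1 := by
  have h : IsTriangular 0 := ⟨0, rfl⟩
  rw [triangleSeriesC, ← coeff_zero_eq_constantCoeff_apply, coeff_map, triangleSeries, coeff_mk,
    if_pos h]
  simp

theorem two_mul_triangle (r : ℕ) : 2 * (r * (r + 1) / 2) = r * (r + 1) :=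
  Nat.mul_div_cancel' (Nat.even_mul_succ_self r).two_dvd

theorem hasSum_triangleSeriesC :
    HasSum (fun r : ℕ => (X : ℂ⟦X⟧) ^ (r * (r + 1) / 2)) triangleSeriesC := by
  rw [WithPiTopology.hasSum_iff_hasSum_coeff]
  intro t
  simp only [coeff_X_pow, triangleSeriesC, coeff_map, triangleSeries, coeff_mk]
  by_cases h : IsTriangular t
  · obtain ⟨r, hr⟩ := id h
    rw [if_pos h]
    have h1 := hasSum_single (f := fun i : ℕ => if t = i * (i + 1) / 2 then (1 : ℂ) else 0) r
      fun i hi => by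
        refine if_neg fun h' => hi ?_
        have e1 := two_mul_triangle i
        have e2 := two_mul_triangle r
        rw [← h'] at e1
        rw [← hr, e1] at e2
        rcases lt_trichotomy i r with h | h | h
        · nlinarith
        · exact h
        · nlinarith
    refine hasSum_of_eq h1 ?_
    simp [hr]
  · rw [if_neg h]
    have e : (fun i : ℕ => if t = i * (i + 1) / 2 then (1 : ℂ) else 0) = fun _ => 0 := by
      funext i
      exact if_neg fun h' => h ⟨i, h'⟩
    rw [e]
    simp

/-- The odd integers are ±(2r+1), and (2r+1)² = 8 · r(r+1)/2 + 1. -/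
theorem hasSum_theta_odd :
    HasSum (thetaTerm Odd) (2 * (X * expand 8 (by norm_num) triangleSeriesC)) := by
  have h := (hasSum_expand (p := 8) (by norm_num) hasSum_triangleSeriesC).mul_left X
  have key : ∀ r : ℕ, ∀ n : ℤ, n.natAbs = 2 * r + 1 →
      X * expand 8 (by norm_num) ((X : ℂ⟦X⟧) ^ (r * (r + 1) / 2)) = thetaTerm Odd n := by
    intro r n hn
    have : Odd n := by rw [← Int.natAbs_odd, hn]; exact ⟨r, rfl⟩
    rw [thetaTerm, if_pos this, map_pow, expand_X, hn, ← pow_mul, ← pow_succ']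
    congr 1
    have := two_mul_triangle r
    nlinarith
  have inj1 : Function.Injective fun j : ℤ => 2 * j + 1 := fun a b h => by
    simp only at h; omega
  rw [← inj1.hasSum_iff]
  · rw [two_mul]
    refine HasSum.of_nat_of_neg_add_one ((hasSum_congr_fun fun r => ?_).mp h)
      ((hasSum_congr_fun fun r => ?_).mp h)
    · exact key r _ (by simp only; omega)
    · exact key r _ (by simp only; omega)
  · intro n hn
    refine if_neg ?_
    rintro ⟨j, hj⟩
    exact hn ⟨j, hj.symm⟩

/-- Both (o², e²), for the odd and even theta series, and (4L(q²), A(q⁴)) satisfy the relations of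
`agm_unique`; hence 4L(q²) = o². -/
theorem two_triangles_lambert {L A : ℂ⟦X⟧} (hA : A = 4 * L + expand 2 two_ne_zero A)
    (hL : L ^ 2 = expand 2 two_ne_zero L * expand 2 two_ne_zero (expand 2 two_ne_zero A))
    {l : ℂ⟦X⟧} (hl : L = X * l) (hl1 : constantCoeff l = 1) (hA1 : constantCoeff A = 1) :
    L = X * expand 4 (by norm_num) triangleSeriesC ^ 2 := by
  obtain ⟨e, he⟩ := (isSmall_thetaTerm Even).summable
  have ho := hasSum_theta_odd
  obtain ⟨t1, t2⟩ := theta_odd_sq ho he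
  set T : ℂ⟦X⟧ := expand 8 (by norm_num) triangleSeriesC with hT
  have hT1 : constantCoeff T = 1 := by rw [hT, constantCoeff_expand, constantCoeff_triangleSeriesC]
  have e1 : (2 * (X * T)) ^ 2 = X ^ 2 * (4 * T ^ 2) := by ring
  have e2 : 4 * expand 2 two_ne_zero L = X ^ 2 * (4 * expand 2 two_ne_zero l) := by
    rw [hl, map_mul, expand_X]; ring
  have hce : constantCoeff e = 1 := by
    have h := (WithPiTopology.hasSum_iff_hasSum_coeff (R := ℂ)).mp he 0
    rw [← coeff_zero_eq_constantCoeff_apply]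
    refine h.unique ?_
    refine hasSum_of_eq (hasSum_single 0 fun n hn => ?_) ?_
    · rw [thetaTerm]
      split_ifs
      · rw [coeff_X_pow, if_neg]
        have := Int.natAbs_pos.mpr hn
        positivity
      · simp
    · simp [thetaTerm]
  have main := agm_unique (u := 4 * T ^ 2) (v := e ^ 2) (u' := 4 * expand 2 two_ne_zero l)
    (v' := expand 2 two_ne_zero (expand 2 two_ne_zero A)) ?_ ?_ ?_ ?_ ?_ ?_ ?_
  · have h3 : expand 2 two_ne_zero L =
        expand 2 two_ne_zero (X * expand 4 (by norm_num) triangleSeriesC ^ 2) := by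
      have h4 : (4 : ℂ⟦X⟧) ≠ 0 := OfNat.ofNat_ne_zero 4
      apply mul_left_cancel₀ h4
      rw [e2, ← main, map_mul, map_pow, expand_X, ← expand_mul]
      ring
    exact expand_injective two_ne_zero h3
  · rw [← e1, map_pow, map_pow, t2]; ring
  · rw [← e1, map_pow (expand 2 two_ne_zero), map_pow (expand 2 two_ne_zero),
      show ((2 * (X * T)) ^ 2) ^ 2 = (2 * expand 2 two_ne_zero (2 * (X * T)) *
        expand 2 two_ne_zero e) ^ 2 by rw [t1]]
    ring
  · have h := congrArg (expand 2 two_ne_zero) (congrArg (expand 2 two_ne_zero) hA)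
    rw [map_add, map_add, map_mul (expand 2 two_ne_zero) 4 L, map_ofNat] at h
    rw [← e2]
    exact h
  · rw [← e2, mul_pow, ← map_pow, hL, map_mul, map_mul, map_ofNat]; ring
  · rw [map_mul, map_pow, hT1, map_ofNat]; norm_num
  · rw [map_mul, constantCoeff_expand, hl1, map_ofNat]; norm_num
  · simp [hce, hA1]

end Theta

/-! ### Four triangular numbers, from the elliptic identities at x = i. -/

section FourTriangles

open PowerSeries

/-- The imaginary unit as a unit. -/
noncomputable def unitI : ℂˣ := Units.mk0 Complex.I Complex.I_ne_zero

theorem unitI_val : (unitI : ℂ) = Complex.I := rfl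

theorem unitI_inv_val : ((unitI⁻¹ : ℂˣ) : ℂ) = -Complex.I := by
  rw [Units.val_inv_eq_inv_val, unitI_val, Complex.inv_I]

/-- At x = i and k = 2j, the two series in `sinhSeries_sq` combine to 4j((-1)^j - 1), which is -8j
for odd j and 0 otherwise. -/
theorem sinhSeries_unitI_sq :
    sinhSeries unitI ^ 2 = -4 * expand 2 two_ne_zero (oddMoment 0) := by
  have h := sinhSeries_sq unitI
  rw [← lambert_swap fun k l => if Even l ∧ Odd k then 2 * (l : ℂ) else 0] at h
  have e : 2 * coshSeries unitI =
      (lambert fun l k => if Even l ∧ Odd k then 2 * (l : ℂ) else 0) +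
        2 * (-4 * expand 2 two_ne_zero (oddMoment 0)) := by
    have h8 : 2 * (-4 * expand 2 two_ne_zero (oddMoment 0)) =
        C (-8 : ℂ) * expand 2 two_ne_zero (oddMoment 0) := by
      rw [map_neg, map_ofNat]; ring
    rw [h8, ← map_ofNat (C (R := ℂ)) 2, coshSeries, oddMoment, expand_lambert, C_mul_lambert,
      C_mul_lambert, ← lambert_add]
    refine lambert_congr fun k l => ?_
    by_cases hl : Odd l <;> by_cases hk : Even k <;> simp only [hl, hk, and_self, and_true,
      and_false, if_true, if_false, true_and, false_and, mul_zero, add_zero]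
    · obtain ⟨j, rfl⟩ := hk
      rw [show (j + j) / 2 = j by omega, unitI_val, unitI_inv_val, Even.neg_pow ⟨j, rfl⟩,
        ← two_mul, show Complex.I ^ (j + j) = (-1) ^ j by rw [← two_mul, pow_mul, Complex.I_sq]]
      rcases Nat.even_or_odd j with hj | hj
      · rw [hj.neg_one_pow, if_neg (by simpa using hj)]
        push_cast
        norm_num
        ring
      · rw [hj.neg_one_pow, if_pos hj]
        push_cast
        norm_num
        ring
  have h2 : (2 : ℂ⟦X⟧) ≠ 0 := two_ne_zero
  apply mul_left_cancel₀ h2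
  rw [h, e]
  ring

/-- The series `∑_{k odd, l ≥ 1} (i^k - i^{-k}) q^{kl}` with constant term `i / 2`. -/
noncomputable def cosineSeries : ℂ⟦X⟧ :=
  C (Complex.I / 2) + lambert fun k _ =>
    if Odd k then (unitI : ℂ) ^ k - ((unitI⁻¹ : ℂˣ) : ℂ) ^ k else 0

theorem expand_cosineSeries : expand 2 two_ne_zero cosineSeries =
    C ((unitI : ℂ) * Ring.inverse (1 - (unitI : ℂ) ^ 2)) + lambert fun k l =>
      if Even l ∧ Odd k then (unitI : ℂ) ^ k - ((unitI⁻¹ : ℂˣ) : ℂ) ^ k else 0 := by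
  rw [cosineSeries, map_add, expand_C, ← lambert_swap, expand_lambert, ← lambert_swap]
  congr 1
  · congr 1
    rw [Ring.inverse_eq_inv', unitI_val, Complex.I_sq]
    norm_num
    ring
  · refine lambert_congr fun k l => ?_
    by_cases hl : Even l <;> simp [hl]

theorem cosineSeries_eq :
    cosineSeries = sinhSeries unitI + expand 2 two_ne_zero cosineSeries := by
  rw [expand_cosineSeries, add_left_comm, sinhSeries, ← lambert_add, cosineSeries]
  congr 1
  · congr 1
    rw [Ring.inverse_eq_inv', unitI_val, Complex.I_sq]
    norm_num
    ring
  · refine lambert_congr fun k l => ?_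
    rcases Nat.even_or_odd l with hl | hl
    · have : ¬ Odd l := by simpa using hl
      simp [hl, this]
    · have : ¬ Even l := by simpa using hl
      simp [hl, this]

theorem sinhSeries_mul_cosineSeries :
    sinhSeries unitI * expand 2 two_ne_zero cosineSeries = -oddMoment 0 := by
  have hu : IsUnit (1 - (unitI : ℂ) ^ 2) := by
    rw [unitI_val, Complex.I_sq]; norm_num
  have h := sinhSeries_mul_even unitI hu
  rw [← expand_cosineSeries] at h
  have e : (lambert fun k l => if Odd l ∧ Odd k then 2 * (l : ℂ) else 0) = 2 * oddMoment 0 := by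
    rw [oddMoment, ← map_ofNat (C (R := ℂ)) 2, C_mul_lambert, ← lambert_swap]
    refine lambert_congr fun k l => ?_
    by_cases hl : Odd l <;> by_cases hk : Odd k <;> simp [hl, hk]
  have h2 : (2 : ℂ⟦X⟧) ≠ 0 := two_ne_zero
  apply mul_left_cancel₀ h2
  rw [h, e]
  ring

/-- Jacobi's theorem on sums of four triangular numbers. -/
theorem oddMoment_zero : oddMoment 0 = X * expand 2 two_ne_zero triangleSeriesC ^ 4 := by
  set P := sinhSeries unitI with hP
  have hI : (C Complex.I : ℂ⟦X⟧) ^ 2 = -1 := by rw [← map_pow, Complex.I_sq, map_neg, map_one]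
  have hhalf : (2 : ℂ⟦X⟧) * C (1 / 2 : ℂ) = 1 := by
    rw [← map_ofNat (C (R := ℂ)) 2, ← map_mul]; norm_num
  -- The factors -i/2 and -2i normalise to L = ∑ (-1)^{(k-1)/2} q^{kl} over odd k, l, and A = 1 + 4
  -- ∑ (-1)^{(k-1)/2} q^{kl} over odd k and all l ≥ 1.
  have hL2 : (-(C Complex.I * C (1 / 2 : ℂ)) * P) ^ 2 = expand 2 two_ne_zero (oddMoment 0) := by
    have h := sinhSeries_unitI_sq
    rw [← hP] at h
    linear_combination (C (1 / 2 : ℂ)) ^ 2 * P ^ 2 * hI - (C (1 / 2 : ℂ)) ^ 2 * h +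
      expand 2 two_ne_zero (oddMoment 0) * (2 * C (1 / 2 : ℂ) + 1) * hhalf
  have hLA : (-(C Complex.I * C (1 / 2 : ℂ)) * P) *
      expand 2 two_ne_zero (-(2 * C Complex.I) * cosineSeries) = oddMoment 0 := by
    have h := sinhSeries_mul_cosineSeries
    rw [← hP] at h
    rw [map_mul, map_neg, map_mul, map_ofNat, expand_C]
    linear_combination P * expand 2 two_ne_zero cosineSeries * (2 * C (1 / 2 : ℂ)) * hI -
      h - P * expand 2 two_ne_zero cosineSeries * hhalf
  have hX : X ∣ P := by
    rw [X_dvd_iff, ← coeff_zero_eq_constantCoeff_apply]; exact coeff_zero_lambert _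
  obtain ⟨l, hl⟩ := hX
  have hl1 : constantCoeff l = 2 * Complex.I := by
    have h1 : coeff 1 P = 2 * Complex.I := by
      rw [hP, sinhSeries, lambert, coeff_mk]
      simp [unitI_val]
      ring
    have h2 : coeff (0 + 1) (X * l) = coeff 0 l := coeff_succ_X_mul 0 l
    rw [zero_add] at h2
    rw [hl, h2, coeff_zero_eq_constantCoeff_apply] at h1
    exact h1
  have key := two_triangles_lambert (L := -(C Complex.I * C (1 / 2 : ℂ)) * P)
    (A := -(2 * C Complex.I) * cosineSeries) (l := -(C Complex.I * C (1 / 2 : ℂ)) * l) ?_ ?_ ?_ ?_ ?_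
  · rw [key] at hL2
    apply expand_injective two_ne_zero
    rw [← hL2, map_mul, map_pow, expand_X, ← expand_mul]
    ring
  · have h := cosineSeries_eq
    rw [← hP] at h
    rw [map_mul, map_neg, map_mul, map_ofNat, expand_C]
    linear_combination -(2 * C Complex.I) * h + 2 * C Complex.I * P * hhalf
  -- With M = `oddMoment 0`, L² = M(q²) and M = L · A(q²), so L² = L(q²) A(q⁴).
  · rw [hL2, ← hLA, map_mul]
  · rw [hl]; ring
  · rw [map_mul, hl1, map_neg, map_mul, constantCoeff_C, constantCoeff_C]
    linear_combination -Complex.I_sq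
  · have h0 : constantCoeff cosineSeries = Complex.I / 2 := by
      rw [cosineSeries, map_add, constantCoeff_C, ← coeff_zero_eq_constantCoeff_apply (lambert _),
        coeff_zero_lambert, add_zero]
    rw [map_mul, h0, map_neg, map_mul, constantCoeff_C, map_ofNat]
    linear_combination -Complex.I_sq

end FourTriangles

/-! ### Andréief's identity for Lambert series. -/

section Andreief

open PowerSeries

theorem coeff_prod_lambert {m : ℕ} (c : ℕ → ℕ → Prop) [∀ k l, Decidable (c k l)]
    (hc : ∀ k l, c k l → 0 < k ∧ 0 < l) (v : Fin m → ℕ → ℂ) (N : ℕ)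
    (T : Finset ((Fin m → ℕ) × (Fin m → ℕ)))
    (hT : ∀ p, p ∈ T ↔ (∀ i, c (p.1 i) (p.2 i)) ∧ ∑ i, p.1 i * p.2 i = N) :
    coeff N (∏ i, lambert fun k l => if c k l then v i k else 0) =
      ∑ p ∈ T, ∏ i, v i (p.1 i) := by
  classical
  rw [coeff_prod]
  simp only [lambert, coeff_mk]
  simp only [Finset.prod_univ_sum, Finset.prod_ite_zero]
  rw [Finset.sum_sigma']
  refine Eq.trans (Finset.sum_congr rfl fun _ _ => ?_) ((Finset.sum_filter
    (fun x : (_ : Fin m →₀ ℕ) × (Fin m → ℕ × ℕ) =>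
    ∀ i ∈ Finset.univ, c (x.2 i).1 (x.2 i).2) (fun x => ∏ i, v i (x.2 i).1)).symm.trans ?_)
  · congr
  refine Finset.sum_bij' (fun q _ => (fun i => (q.2 i).1, fun i => (q.2 i).2))
    (fun p _ => ⟨Finsupp.equivFunOnFinite.symm fun i => p.1 i * p.2 i, fun i => (p.1 i, p.2 i)⟩)
    ?_ ?_ ?_ ?_ ?_
  · rintro ⟨l, q⟩ h
    simp only [Finset.mem_filter, Finset.mem_sigma, Finset.mem_finsuppAntidiag,
      Fintype.mem_piFinset, Nat.mem_divisorsAntidiagonal, Finset.mem_univ, true_implies] at h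
    rw [hT]
    refine ⟨h.2, ?_⟩
    rw [← h.1.1.1]
    exact Finset.sum_congr rfl fun i _ => (h.1.2 i).1
  · rintro ⟨k, l⟩ h
    rw [hT] at h
    simp only [Finset.mem_filter, Finset.mem_sigma, Finset.mem_finsuppAntidiag,
      Fintype.mem_piFinset, Nat.mem_divisorsAntidiagonal, Finset.mem_univ, true_implies]
    refine ⟨⟨⟨?_, Finset.subset_univ _⟩, fun i => ⟨by simp, ?_⟩⟩, h.1⟩
    · rw [← h.2]; simp
    · have := hc _ _ (h.1 i)
      simp only [Finsupp.equivFunOnFinite_symm_apply_apply]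
      exact (Nat.mul_pos this.1 this.2).ne'
  · rintro ⟨l, q⟩ h
    simp only [Finset.mem_filter, Finset.mem_sigma, Finset.mem_finsuppAntidiag,
      Fintype.mem_piFinset, Nat.mem_divisorsAntidiagonal, Finset.mem_univ, true_implies] at h
    simp only [Prod.mk.eta, Sigma.mk.injEq, heq_eq_eq, and_true]
    ext i
    simpa using (h.1.2 i).1
  · intros; rfl
  · intros; rfl

/-- Write the squared Vandermonde as a double sum over permutations σ, τ. Each pair contributes a
coefficient of a product of moments, and for fixed σ the sum over τ is the whole determinant; there
are m! choices of σ. -/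
theorem sum_solutions_eq_det {m : ℕ} (c : ℕ → ℕ → Prop) [∀ k l, Decidable (c k l)]
    (hc : ∀ k l, c k l → 0 < k ∧ 0 < l) (g : ℕ → ℂ) (N : ℕ)
    (T : Finset ((Fin m → ℕ) × (Fin m → ℕ)))
    (hT : ∀ p, p ∈ T ↔ (∀ i, c (p.1 i) (p.2 i)) ∧ ∑ i, p.1 i * p.2 i = N) :
    ∑ p ∈ T, (∏ i, g (p.1 i)) *
        ∏ i : Fin m, ∏ j ∈ Finset.Ioi i, ((p.1 j : ℂ) ^ 2 - (p.1 i : ℂ) ^ 2) ^ 2 =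
      m ! * coeff N (Matrix.of fun i j : Fin m => lambert fun k l =>
        if c k l then g k * (k : ℂ) ^ (2 * ((i : ℕ) + j)) else 0).det := by
  set H : Matrix (Fin m) (Fin m) ℂ⟦X⟧ := Matrix.of fun i j : Fin m => lambert fun k l =>
        if c k l then g k * (k : ℂ) ^ (2 * ((i : ℕ) + j)) else 0 with hH
  have vand : ∀ k : Fin m → ℕ,
      ∏ i : Fin m, ∏ j ∈ Finset.Ioi i, ((k j : ℂ) ^ 2 - (k i : ℂ) ^ 2) ^ 2 =
      (∑ σ : Equiv.Perm (Fin m), ((Equiv.Perm.sign σ : ℤ) : ℂ) *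
        ∏ i, ((k i : ℂ) ^ 2) ^ ((σ i : Fin m) : ℕ)) ^ 2 := by
    intro k
    have h1 := Matrix.det_vandermonde fun i => (k i : ℂ) ^ 2
    rw [← Matrix.det_transpose, Matrix.det_apply'] at h1
    simp only [Matrix.transpose_apply, Matrix.vandermonde_apply] at h1
    rw [h1]
    simp only [Finset.prod_pow]
  have key : ∀ σ τ : Equiv.Perm (Fin m),
      ∑ p ∈ T, (∏ i, g (p.1 i)) * ((∏ i, ((p.1 i : ℂ) ^ 2) ^ ((σ i : Fin m) : ℕ)) *
        ∏ i, ((p.1 i : ℂ) ^ 2) ^ ((τ i : Fin m) : ℕ)) = coeff N (∏ i, H (σ i) (τ i)) := by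
    intro σ τ
    rw [hH]
    simp only [Matrix.of_apply]
    rw [coeff_prod_lambert c hc (fun i k => g k * (k : ℂ) ^ (2 * ((σ i : ℕ) + τ i))) N T hT]
    refine Finset.sum_congr rfl fun p _ => ?_
    rw [← Finset.prod_mul_distrib, ← Finset.prod_mul_distrib]
    refine Finset.prod_congr rfl fun i _ => ?_
    rw [← pow_mul, ← pow_mul, ← pow_add, mul_add]
  have row : ∀ σ : Equiv.Perm (Fin m), ∑ τ : Equiv.Perm (Fin m),
      ((Equiv.Perm.sign σ : ℤ) : ℂ) * ((Equiv.Perm.sign τ : ℤ) : ℂ) *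
        coeff N (∏ i, H (σ i) (τ i)) = coeff N H.det := by
    intro σ
    have h1 : (H.submatrix σ id).transpose.det = ((Equiv.Perm.sign σ : ℤ) : ℂ⟦X⟧) * H.det := by
      rw [Matrix.det_transpose, Matrix.det_permute]
    rw [Matrix.det_apply'] at h1
    simp only [Matrix.transpose_apply, Matrix.submatrix_apply, id] at h1
    have h2 : H.det = ((Equiv.Perm.sign σ : ℤ) : ℂ⟦X⟧) *
        ∑ τ : Equiv.Perm (Fin m), ((Equiv.Perm.sign τ : ℤ) : ℂ⟦X⟧) * ∏ i, H (σ i) (τ i) := by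
      rw [h1, ← mul_assoc, ← Int.cast_mul, Int.units_coe_mul_self, Int.cast_one, one_mul]
    rw [h2, Finset.mul_sum, map_sum]
    refine Finset.sum_congr rfl fun τ _ => ?_
    rw [← map_intCast (C (R := ℂ)), ← map_intCast (C (R := ℂ)), coeff_C_mul, coeff_C_mul, mul_assoc]
  calc _ = ∑ p ∈ T, ∑ σ : Equiv.Perm (Fin m), ∑ τ : Equiv.Perm (Fin m),
        ((Equiv.Perm.sign σ : ℤ) : ℂ) * ((Equiv.Perm.sign τ : ℤ) : ℂ) *
        ((∏ i, g (p.1 i)) * ((∏ i, ((p.1 i : ℂ) ^ 2) ^ ((σ i : Fin m) : ℕ)) *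
        ∏ i, ((p.1 i : ℂ) ^ 2) ^ ((τ i : Fin m) : ℕ))) := by
        refine Finset.sum_congr rfl fun p _ => ?_
        rw [vand, sq, Finset.sum_mul_sum, Finset.mul_sum]
        refine Finset.sum_congr rfl fun σ _ => ?_
        rw [Finset.mul_sum]
        refine Finset.sum_congr rfl fun τ _ => ?_
        ring
    _ = ∑ σ : Equiv.Perm (Fin m), ∑ τ : Equiv.Perm (Fin m),
        ((Equiv.Perm.sign σ : ℤ) : ℂ) * ((Equiv.Perm.sign τ : ℤ) : ℂ) *
          coeff N (∏ i, H (σ i) (τ i)) := by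
        rw [Finset.sum_comm]
        refine Finset.sum_congr rfl fun σ _ => ?_
        rw [Finset.sum_comm]
        refine Finset.sum_congr rfl fun τ _ => ?_
        rw [← key, Finset.mul_sum]
    _ = _ := by
        rw [Finset.sum_congr rfl fun σ _ => row σ, Finset.sum_const, Finset.card_univ,
          Fintype.card_perm, Fintype.card_fin, nsmul_eq_mul]

end Andreief

/-! ### Comparison of coefficients. -/

section Final

open PowerSeries

theorem coeff_triangleSeriesC_pow (k n : ℕ) :
    coeff n (triangleSeriesC ^ k) = (triangleCount k n : ℂ) := by
  rw [triangleSeriesC, ← map_pow, coeff_map, coeff_triangleSeries_pow]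
  rfl

theorem coeff_oddMoment_zero_pow (k n : ℕ) :
    coeff (2 * n + k) (oddMoment 0 ^ k) = (triangleCount (4 * k) n : ℂ) := by
  rw [oddMoment_zero, mul_pow, coeff_X_pow_mul, ← pow_mul, ← map_pow, coeff_expand_mul,
    coeff_triangleSeriesC_pow]

theorem prod_oddMoment_odd (z : ℂ⟦X⟧) (m : ℕ) :
    ∏ n ∈ Finset.range m, (z ^ (2 * n + 1) * 16 ^ n * (2 * n)! * (2 * n + 1)!) =
      C ((4 : ℂ) ^ (m * (m - 1)) * ∏ j ∈ Finset.Icc 1 (2 * m - 1), (j ! : ℂ)) * z ^ (m ^ 2) := by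
  induction m with
  | zero => simp
  | succ m ih =>
    rw [Finset.prod_range_succ, ih]
    have e : ∏ j ∈ Finset.Icc 1 (2 * (m + 1) - 1), (j ! : ℂ) =
        (∏ j ∈ Finset.Icc 1 (2 * m - 1), (j ! : ℂ)) * (2 * m)! * (2 * m + 1)! := by
      rcases m with _ | m
      · simp
      · rw [show 2 * (m + 1 + 1) - 1 = 2 * (m + 1) - 1 + 1 + 1 by omega,
          Finset.prod_Icc_succ_top (by omega), Finset.prod_Icc_succ_top (by omega),
          show 2 * (m + 1) - 1 + 1 = 2 * (m + 1) by omega]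
    have e4 : (4 : ℂ) ^ ((m + 1) * (m + 1 - 1)) = 4 ^ (m * (m - 1)) * 16 ^ m := by
      rw [show (16 : ℂ) = 4 ^ 2 by norm_num, ← pow_mul, ← pow_add]
      congr 1
      rcases m with _ | m
      · rfl
      · simp only [Nat.add_sub_cancel]; ring
    rw [e, e4]
    simp only [map_mul, map_pow, map_natCast, map_ofNat]
    ring

theorem prod_oddMoment_even (z : ℂ⟦X⟧) (m : ℕ) :
    ∏ n ∈ Finset.range m, (z ^ (2 * n + 2) * (2 * n + 1)! * (2 * n + 2)!) =
      C (∏ j ∈ Finset.Icc 1 (2 * m), (j ! : ℂ)) * z ^ (m * (m + 1)) := by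
  induction m with
  | zero => simp
  | succ m ih =>
    rw [Finset.prod_range_succ, ih, show 2 * (m + 1) = 2 * m + 1 + 1 by ring,
      Finset.prod_Icc_succ_top (by omega), Finset.prod_Icc_succ_top (by omega)]
    simp only [map_mul, map_natCast]
    ring

theorem prod_factorial_ne_zero (N : ℕ) : ∏ j ∈ Finset.Icc 1 N, (j ! : ℂ) ≠ 0 :=
  Finset.prod_ne_zero_iff.mpr fun j _ => Nat.cast_ne_zero.mpr (Nat.factorial_ne_zero j)

theorem triangleCount_four_mul_sq (m n : ℕ) :
    (triangleCount (4 * m ^ 2) n : ℂ) =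
      1 / ((4 : ℂ) ^ (m * (m - 1)) * (m ! : ℂ) * ∏ j ∈ Finset.Icc 1 (2 * m - 1), (j ! : ℂ)) *
        ∑ p ∈ (oddOddSolutions_finite m (2 * n + m ^ 2)).toFinset, (∏ i, (p.1 i : ℂ)) *
          ∏ i : Fin m, ∏ j ∈ Finset.Ioi i, ((p.1 j : ℂ) ^ 2 - (p.1 i : ℂ) ^ 2) ^ 2 := by
  have h := sum_solutions_eq_det (m := m) (fun k l => Odd l ∧ Odd k) (fun k l h => ⟨h.2.pos, h.1.pos⟩)
    (fun k => (k : ℂ)) (2 * n + m ^ 2) (oddOddSolutions_finite m (2 * n + m ^ 2)).toFinset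
    (fun p => by
      rw [Set.Finite.mem_toFinset]
      constructor
      · rintro ⟨h1, h2, h3⟩
        exact ⟨fun i => ⟨(h2 i).1, (h1 i).1⟩, h3⟩
      · rintro ⟨h1, h3⟩
        exact ⟨fun i => ⟨(h1 i).2, (h1 i).2.pos⟩, fun i => ⟨(h1 i).1, (h1 i).1.pos⟩, h3⟩)
  have e : (Matrix.of fun i j : Fin m => lambert fun k l =>
      if Odd l ∧ Odd k then (k : ℂ) * (k : ℂ) ^ (2 * ((i : ℕ) + j)) else 0) =
      Matrix.of fun i j : Fin m => oddMoment (i + j) := by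
    ext1 i j
    simp only [Matrix.of_apply, oddMoment, pow_succ']
  rw [h, e, det_oddMoment, prod_oddMoment_odd, coeff_C_mul, coeff_oddMoment_zero_pow]
  have h1 := prod_factorial_ne_zero (2 * m - 1)
  have h2 : (m ! : ℂ) ≠ 0 := Nat.cast_ne_zero.mpr (Nat.factorial_ne_zero m)
  have h3 : (4 : ℂ) ^ (m * (m - 1)) ≠ 0 := pow_ne_zero _ (by norm_num)
  field_simp

theorem triangleCount_four_mul_mul_succ (m n : ℕ) :
    (triangleCount (4 * m * (m + 1)) n : ℂ) =
      (2 : ℂ) ^ m / ((m ! : ℂ) * ∏ j ∈ Finset.Icc 1 (2 * m), (j ! : ℂ)) *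
        ∑ p ∈ (posOddSolutions_finite m (n + m * (m + 1) / 2)).toFinset, (∏ i, (p.1 i : ℂ) ^ 3) *
          ∏ i : Fin m, ∏ j ∈ Finset.Ioi i, ((p.1 j : ℂ) ^ 2 - (p.1 i : ℂ) ^ 2) ^ 2 := by
  set M := n + m * (m + 1) / 2 with hM
  have h := sum_solutions_eq_det (m := m) (fun k l => 0 < k ∧ Odd l) (fun k l h => ⟨h.1, h.2.pos⟩)
    (fun k => (k : ℂ) ^ 3) M (posOddSolutions_finite m M).toFinset
    (fun p => by
      rw [Set.Finite.mem_toFinset]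
      constructor
      · rintro ⟨h1, h2, h3⟩
        exact ⟨fun i => ⟨h1 i, (h2 i).1⟩, h3⟩
      · rintro ⟨h1, h3⟩
        exact ⟨fun i => (h1 i).1, fun i => ⟨(h1 i).2, (h1 i).2.pos⟩, h3⟩)
  have e : (Matrix.of fun i j : Fin m => lambert fun k l =>
      if 0 < k ∧ Odd l then (k : ℂ) ^ 3 * (k : ℂ) ^ (2 * ((i : ℕ) + j)) else 0) =
      Matrix.of fun i j : Fin m => moment (i + j + 1) := by
    ext1 i j
    simp only [Matrix.of_apply, moment]
    refine lambert_congr fun k l => ?_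
    -- `moment` does not require k > 0, but its summand at k = 0 vanishes.
    rcases Nat.eq_zero_or_pos k with rfl | hk
    · simp
    · simp only [hk, true_and, ← pow_add]
      congr 2
      ring
  have h4 := congrArg (coeff (2 * n + m * (m + 1))) (det_moment m)
  rw [prod_oddMoment_even, coeff_C_mul, coeff_oddMoment_zero_pow,
    ← map_ofNat (C (R := ℂ)) 2, ← map_pow, coeff_C_mul,
    show 2 * n + m * (m + 1) = 2 * M by have := two_mul_triangle m; omega,
    coeff_expand_mul, ← mul_assoc] at h4
  rw [h, e]
  have h1 := prod_factorial_ne_zero (2 * m)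
  have h2 : (m ! : ℂ) ≠ 0 := Nat.cast_ne_zero.mpr (Nat.factorial_ne_zero m)
  field_simp
  rw [mul_comm]
  exact h4.symm

end Final

theorem mainTheorem4 (m n : ℕ) :
    (triangleCount (4 * m ^ 2) n : ℚ) =
        1 / ((4 : ℚ) ^ (m * (m - 1)) * (m ! : ℚ) * ∏ j ∈ Finset.Icc 1 (2 * m - 1), (j ! : ℚ)) *
          ∑ p ∈ (oddOddSolutions_finite m (2 * n + m ^ 2)).toFinset,
            (∏ i, (p.1 i : ℚ)) * sqVandermondeSq p.1 ∧
    (triangleCount (4 * m * (m + 1)) n : ℚ) =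
        (2 : ℚ) ^ m / ((m ! : ℚ) * ∏ j ∈ Finset.Icc 1 (2 * m), (j ! : ℚ)) *
          ∑ p ∈ (posOddSolutions_finite m (n + m * (m + 1) / 2)).toFinset,
            (∏ i, (p.1 i : ℚ) ^ 3) * sqVandermondeSq p.1 := by
  constructor
  · have h := triangleCount_four_mul_sq m n
    simp only [sqVandermondeSq]
    -- The identities were proved over ℂ, where i is available for the four triangle theorem.
    apply Rat.cast_injective (α := ℂ)
    push_cast
    exact h
  · have h := triangleCount_four_mul_mul_succ m n
    simp only [sqVandermondeSq]
    apply Rat.cast_injective (α := ℂ)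
    push_cast
    exact h
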